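/- Let $\mathcal O$ be an orbifold (possibly with punctures) all of whose orbifold points have order $\ge 3$, with an ideal triangulation $T$ glued from ordinary triangles (possibly self-folded) and pending triangles (monogons around one orbifold point, bounded by a pending arc; the other side of a pending arc is a side of an ordinary triangle). Let $\gamma$ be a (possibly generalized) arc or a closed curve on $\mathcal O$ in minimal position with $T$, winding $k\in\{0,\dots,\mathbf p-2\}$ times counterclockwise whenever it crosses a pending triangle around a point of order $\mathbf p$. Assume: if $\gamma$ is an arc, each end is plain or notched at a puncture, the underlying plain arc crosses $T$ (is not in $T$), no notched end lies in a pending triangle ($\gamma$ is not a notched corner arc) or is at the puncture inside a self-folded triangle; if $\gamma$ is closed, it passes through an ordinary triangle and is not contractible to a puncture. A notched end is replaced by a hook, nearly a full clockwise revolution around the puncture; let $c_1,\dots,c_d$ be the crossings of the resulting curve with $T$. The snake graph with hexagonal tiles $\mathcal G^{\mathrm{gen}}_{\gamma,T}$ is built from one square tile $G_j$ per crossing $c_j$, whose diagonal is the crossed arc and whose sides are those of the two adjacent triangles; the tiles have alternating orientation, the first one positive. If $\gamma$ goes from $c_j$ to $c_{j+1}$ through an ordinary triangle, $G_j$ and $G_{j+1}$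 are glued along the edge labelled by the third side of that triangle. If it goes through a pending triangle with winding number $k$, then: for $k=0$ (resp. $k=\mathbf p-2$) they are glued as if the common endpoint of the crossed arcs were to the right (resp. left) of $\gamma$; for $0<k<\mathbf p-2$ the two tiles are replaced by one hexagonal tile, a hexagon with two diagonals (for $c_j$ and $c_{j+1}$) and two crossing edges, namely two square tiles glued along one of the crossing edges, with the other one added. For a closed curve, the edges of the first and last tile labelled by the third side of the triangle where $\gamma$ closes up are glued (band graph); at a notched end, the edges labelled by the last spoke of the hook on the outermost tile of the hook and on the tile of the adjacent crossing of the plain arc are glued (loop graph). Matchings are perfect matchings; for band and loop graphs, those that extend to a perfect matching of the unglued graph by adding copies of glued edges. The minimal matching $M_-$ is the perfect matching (of the unglued graph) that consists of boundary edges (edges bordering only one tile and not crossing edges of a hexagonal tile) and uses the south edge of $G_1$. Matchings are ordered by containment of the sets of diagonals enclosed by the cycles of $M\ominus M_-$, computed for the extensions in the glued case. The poset $\mathcal P_\gamma$ has elements $v_1,\dots,v_d$ and an auxiliary element $v_{(\rho,j)}$ for each $j$ such that $\gamma$ winds $0<k<\mathbf p-2$ times around an orbifold point between $c_j$ and $c_{j+1}$.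 Its order is generated by $v_j\preceq v_{(\rho,j)}\succeq v_{j+1}$ in that case, and otherwise by $v_j\preceq v_{j+1}$ if the common endpoint of the two crossed arcs is to the left of $\gamma$ (or $k=\mathbf p-2$) and $v_j\succeq v_{j+1}$ if it is to the right (or $k=0$). For a closed curve the same rule also relates $v_d$ and $v_1$; for a notched end, it also relates the outermost spoke crossed by the hook and the adjacent crossing of the underlying plain arc. Theorem. $\mathcal P_\gamma$ is a poset, the matchings of $\mathcal G^{\mathrm{gen}}_{\gamma,T}$ with the order above form a distributive lattice, and the poset of join-irreducible elements of this lattice is isomorphic to the induced subposet of $\mathcal P_\gamma$ on the complement of the auxiliary elements. -/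

import Mathlib

/-!
# Triangulated orbifolds, curves on them, snake graphs with hexagonal tiles, and fence posets
-/

universe u v

/-! ## Triangulated orbifolds and curves -/

/-- An ideal triangulation of an orbifold, as a gluing of ordinary triangles and pending triangles.
The sides of an ordinary triangle are numbered `0, 1, 2` counterclockwise; a pending triangle is a
monogon around one orbifold point and has one side, the pending arc.  Sides are glued in pairs
compatibly with the orientation; a side fixed by `glue` is a boundary segment.  A self-folded
triangle is an ordinary triangle two sides of which are glued to each other.  As usual, a pending
arc has an ordinary triangle on its other side (so that it lies in a bigon), and orbifold points
have order at least three. -/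
structure TriangulatedOrbifold where
  /-- the ordinary triangles (including self-folded ones) -/
  Tri : Type u
  /-- the pending triangles, that is, the orbifold points -/
  Pend : Type v
  [finite_tri : Finite Tri]
  [finite_pend : Finite Pend]
  /-- the order of the orbifold point -/
  order : Pend → ℕ
  three_le_order : ∀ p, 3 ≤ order p
  /-- the gluing of sides -/
  glue : (Tri × Fin 3) ⊕ Pend → (Tri × Fin 3) ⊕ Pend
  glue_glue : ∀ s, glue (glue s) = s
  glue_pend : ∀ p, ∃ t, glue (Sum.inr p) = Sum.inl t

/-- How a curve passes from one crossing with the triangulation to the next one: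
* `left`: the two crossed arcs have their common endpoint to the left of the curve
  (or the curve winds `p - 2` times around an orbifold point of order `p`);
* `right`: the common endpoint is to the right (or the curve winds `0` times);
* `hex`: the curve winds `k` times around an orbifold point of order `p`, `0 < k < p - 2`. -/
inductive Turn
  | left
  | right
  | hex
  deriving DecidableEq

namespace TriangulatedOrbifold

variable (O : TriangulatedOrbifold.{u, v})

/-- A side of a triangle of the triangulation. -/
abbrev Side : Type (max u v) := (O.Tri × Fin 3) ⊕ O.Pend

/-- A curve that enters a triangle through `entry` may leave it through `exit`, winding `k` times:
in an ordinary triangle it leaves through a different side; in a pending triangle it leaves through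
the pending arc, after winding `k ∈ {0, …, p - 2}` times counterclockwise around the orbifold
point. -/
def IsPassage : O.Side → O.Side → ℕ → Prop
  | Sum.inl (t, i), Sum.inl (t', i'), _ => t = t' ∧ i ≠ i'
  | Sum.inr p, Sum.inr q, k => p = q ∧ k + 2 ≤ O.order p
  | _, _, _ => False

/-- The turn of a passage.  Entering an ordinary triangle through side `i`, the next side
counterclockwise, `i + 1`, shares with it the endpoint to the right, and `i + 2` the one to the
left. -/
def turn : O.Side → O.Side → ℕ → Turn
  | Sum.inl (_, i), Sum.inl (_, i'), _ => if i' = i + 1 then Turn.right else Turn.left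
  | Sum.inr p, _, k =>
      if k = 0 then Turn.right else if k + 2 = O.order p then Turn.left else Turn.hex
  | _, _, _ => Turn.left

/-- The sequence of crossings of a curve with the triangulation (at least one crossing; the
crossings are numbered `0, …, n`).  The curve leaves the `i`-th triangle through its side `exit i`
and enters the next triangle through `glue (exit i)`; `wind i` is its winding number in the `i`-th
triangle (meaningful only if that triangle is pending). -/
structure CrossingSequence where
  n : ℕ
  exit : Fin (n + 1) → O.Side
  wind : Fin (n + 2) → ℕ
  not_boundary : ∀ i, O.glue (exit i) ≠ exit i
  passage : ∀ i : Fin n,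
    O.IsPassage (O.glue (exit i.castSucc)) (exit i.succ) (wind i.succ.castSucc)

/-- A plain end of an arc, where `s` is the side of the first (last) triangle that the arc crosses.
In an ordinary triangle the arc ends at the vertex opposite to `s`; in a pending triangle it is a
corner arc, which winds `k ∈ {1, …, p - 2}` times around the orbifold point. -/
def IsPlainEnd : O.Side → ℕ → Prop
  | Sum.inl _, _ => True
  | Sum.inr p, k => 1 ≤ k ∧ k + 2 ≤ O.order p

end TriangulatedOrbifold

namespace TriangulatedOrbifold.CrossingSequence

variable {O : TriangulatedOrbifold.{u, v}} (c : O.CrossingSequence)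

/-- The turn between the crossings `i` and `i + 1`. -/
def turnAt (i : Fin c.n) : Turn :=
  O.turn (O.glue (c.exit i.castSucc)) (c.exit i.succ) (c.wind i.succ.castSucc)

/-- The crossings `0, …, j` form a hook that replaces a notch at the start of an arc, and the
crossing `j + 1` is the first one of the underlying plain arc.  That arc starts in an ordinary
triangle `t`, at the puncture `p` opposite to side `i`.  The hook starts in `t` and makes nearly a
full clockwise revolution around `p`, back to `t`: it crosses every spoke at `p` once for every end
of the spoke at `p`.  The puncture `p` is not the one inside a self-folded triangle, so the hook
has at least two crossings. -/
def IsStartHook (j : Fin c.n) : Prop :=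
  1 ≤ j.val ∧
  ∃ (t : O.Tri) (i : Fin 3),
    c.exit 0 = Sum.inl (t, i + 2) ∧
    O.glue (c.exit j.castSucc) = Sum.inl (t, i + 1) ∧
    c.exit j.succ = Sum.inl (t, i) ∧
    (∀ k < j, c.turnAt k = Turn.right) ∧
    ∀ k ≤ j.castSucc, ∀ l ≤ j.castSucc, c.exit k = c.exit l → k = l

/-- The mirror image of `IsStartHook` under reversing the curve: the crossing `j` is the last one of
the underlying plain arc, and the crossings `j + 1, …, n` form a hook around the end of the arc. -/
def IsEndHook (j : Fin c.n) : Prop :=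
  j.val + 2 ≤ c.n ∧
  ∃ (t : O.Tri) (i : Fin 3),
    O.glue (c.exit j.castSucc) = Sum.inl (t, i) ∧
    c.exit j.succ = Sum.inl (t, i + 1) ∧
    O.glue (c.exit (Fin.last c.n)) = Sum.inl (t, i + 2) ∧
    (∀ k > j, c.turnAt k = Turn.left) ∧
    ∀ k ≥ j.succ, ∀ l ≥ j.succ, c.exit k = c.exit l → k = l

/-- The turn from the last crossing of a closed curve to the first one, in an ordinary triangle. -/
def closingTurn : Turn :=
  O.turn (O.glue (c.exit (Fin.last c.n))) (c.exit 0) 0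

/-- The crossing sequence closes up in an ordinary triangle to a closed curve, and the curve is not
contractible to a puncture (that is, it does not turn around one and the same marked point
forever). -/
def IsClosedCurve : Prop :=
  (∃ (t : O.Tri) (i i' : Fin 3), i ≠ i' ∧
    O.glue (c.exit (Fin.last c.n)) = Sum.inl (t, i) ∧ c.exit 0 = Sum.inl (t, i')) ∧
  ∃ k, c.turnAt k ≠ c.closingTurn

/-- The start of an arc: plain (`none`) or notched (`some j`, a hook with crossings `0, …, j`). -/
def Starts : Option (Fin c.n) → Prop
  | none => O.IsPlainEnd (c.exit 0) (c.wind 0)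
  | some j => c.IsStartHook j

/-- The end of an arc: plain (`none`) or notched (`some j`, a hook with crossings
`j + 1, …, n`). -/
def Ends : Option (Fin c.n) → Prop
  | none => O.IsPlainEnd (O.glue (c.exit (Fin.last c.n))) (c.wind (Fin.last (c.n + 1)))
  | some j => c.IsEndHook j

end TriangulatedOrbifold.CrossingSequence

/-- A (possibly generalized) arc or a closed curve on a triangulated orbifold that crosses the
triangulation.  An arc is given by the crossings of its hooked version: each end may be plain or
notched, the underlying plain arc is not in the triangulation, and an end that is notched does not
lie in a pending triangle (there are no notched corner arcs). -/
inductive TriangulatedOrbifold.Curve (O : TriangulatedOrbifold.{u, v}) : Type (max u v)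
  | arc (c : O.CrossingSequence) (startHook endHook : Option (Fin c.n))
      (starts : c.Starts startHook) (ends : c.Ends endHook)
      (lt : ∀ i ∈ startHook, ∀ j ∈ endHook, i < j)
  | closed (c : O.CrossingSequence) (isClosed : c.IsClosedCurve)

/-! ## Graphs -/

/-- A graph in which parallel edges are allowed. -/
structure Multigraph where
  V : Type
  E : Type
  inc : V → E → Prop

/-- A perfect matching: every vertex is incident to exactly one edge of `M`. -/
def Multigraph.IsPerfectMatching (G : Multigraph) (M : Set G.E) : Prop :=
  ∀ x, ∃! e, e ∈ M ∧ G.inc x e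

/-- The graph obtained by identifying vertices and edges. -/
def Multigraph.glue (G : Multigraph) (rV : G.V → G.V → Prop) (rE : G.E → G.E → Prop) :
    Multigraph where
  V := Quot rV
  E := Quot rE
  inc x e := ∃ x₀ e₀, Quot.mk rV x₀ = x ∧ Quot.mk rE e₀ = e ∧ G.inc x₀ e₀

/-! ## Snake graphs with hexagonal tiles -/

/-- The data of a curve that its snake graph and its poset depend on: the turns between consecutive
crossings `0, …, n`, the positions of the hooks at notched ends, and, for a closed curve, the turn
from the last crossing back to the first one. -/
structure SnakeShape where
  n : ℕ
  turn : Fin n → Turn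
  startHook : Option (Fin n)
  endHook : Option (Fin n)
  closing : Option Turn

/-- The shape of a curve. -/
def TriangulatedOrbifold.Curve.shape {O : TriangulatedOrbifold.{u, v}} : O.Curve → SnakeShape
  | .arc c s t _ _ _ => ⟨c.n, c.turnAt, s, t, none⟩
  | .closed c _ => ⟨c.n, c.turnAt, none, none, some c.closingTurn⟩

/-- The two ends of a crossed arc: to the left and to the right of the curve. -/
inductive Hand
  | left
  | right
  deriving DecidableEq

namespace SnakeShape

variable (S : SnakeShape)

/-- The vertices of the snake graph before edges are glued for a closed curve or a notch.

The square tile `j` of the `j`-th crossing has four corners: the two ends `left j` and `right j` of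
its diagonal (the crossed arc), a corner behind the diagonal, in the triangle that the curve comes
from, and a corner ahead of the diagonal, in the triangle that it goes to.  In the plane, the corner
behind is the southwest one and the corner ahead the northeast one; `left j` is the northwest and
`right j` the southeast corner if the tile has positive orientation (`j` even), and vice versa if it
has negative orientation.

Gluing tile `j` to tile `j + 1` along the edge labelled by the third side of the triangle between
the crossings identifies, for a left turn, `right j` with the corner behind tile `j + 1` and
`right (j + 1)` with the corner ahead of tile `j`; and symmetrically for a right turn.  In a
hexagonal tile, `left j, right j, left (j + 1), right (j + 1)` and the corners behind `j` and ahead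
of `j + 1` are the six corners.  So the only other vertices are the corner `source` behind the first
tile and the corner `target` ahead of the last one. -/
inductive Corner
  | source
  | target
  | left (j : Fin (S.n + 1))
  | right (j : Fin (S.n + 1))

/-- The end of the `j`-th diagonal on the given side. -/
def corner : Hand → Fin (S.n + 1) → S.Corner
  | Hand.left, j => Corner.left j
  | Hand.right, j => Corner.right j

/-- Names for the edges of the snake graph: two edges from `source` to the first diagonal, two edges
from the last diagonal to `target`, and the possible edges `link i x y` from the end `x` of the
`i`-th diagonal to the end `y` of the `(i + 1)`-st one. -/
inductive EdgeName
  | source (x : Hand)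
  | target (x : Hand)
  | link (i : Fin S.n) (x y : Hand)

/-- The edges that are present.  The edges `link i x y` with `x ≠ y` are always there.  For a left
(right) turn, the edge between the right (left) ends is the edge shared by the two square tiles, and
there is no edge between the left (right) ends.  A hexagonal tile has both of these edges: they are
its two crossing edges. -/
def IsEdge : S.EdgeName → Prop
  | .link i Hand.left Hand.left => S.turn i ≠ Turn.left
  | .link i Hand.right Hand.right => S.turn i ≠ Turn.right
  | _ => True

/-- The edges of the snake graph. -/
abbrev Edge : Type := {e : S.EdgeName // S.IsEdge e}

/-- Incidence of corners and edges. -/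
def Inc (x : S.Corner) : S.EdgeName → Prop
  | .source h => x = Corner.source ∨ x = S.corner h 0
  | .target h => x = Corner.target ∨ x = S.corner h (Fin.last S.n)
  | .link i h k => x = S.corner h i.castSucc ∨ x = S.corner k i.succ

/-- The snake graph with hexagonal tiles, before edges are glued for a closed curve or a notch. -/
def unglued : Multigraph where
  V := S.Corner
  E := S.Edge
  inc x e := S.Inc x e.1

/-- Boundary edges: those that border only one tile and are not one of the crossing edges of a
hexagonal tile. -/
def IsBoundary : S.EdgeName → Prop
  | .link _ Hand.left Hand.left => False
  | .link _ Hand.right Hand.right => False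
  | _ => True

/-- The boundary edge `e` is a side of the tile `j`.  In a hexagonal tile, which has two diagonals
`i` and `i + 1` and is indexed as two tiles, each half has as sides the two sides of the hexagon that
meet in the corner cut off by its diagonal; the other two sides, which join ends of different
diagonals, are separated from both diagonals by the crossing edges and belong to neither half. -/
def IsSide (j : Fin (S.n + 1)) : S.EdgeName → Prop
  | .source _ => j = 0
  | .target _ => j = Fin.last S.n
  | .link i Hand.left Hand.right =>
      (S.turn i = Turn.left ∧ j = i.castSucc) ∨ (S.turn i = Turn.right ∧ j = i.succ)
  | .link i Hand.right Hand.left =>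
      (S.turn i = Turn.left ∧ j = i.succ) ∨ (S.turn i = Turn.right ∧ j = i.castSucc)
  | _ => False

/-- The minimal matching of the unglued graph: the perfect matching that consists of boundary edges
and uses the south edge of the first tile.  (The first tile has positive orientation, so that its
south edge joins the corner behind the diagonal with the right end of the diagonal.) -/
def IsMinimalMatching (M : Set S.Edge) : Prop :=
  S.unglued.IsPerfectMatching M ∧ (∀ e ∈ M, S.IsBoundary e.1) ∧
    ∃ e ∈ M, e.1 = EdgeName.source Hand.right

/-- The tiles (diagonals) enclosed by the cycles that form the symmetric difference of `M` and the
minimal matching.  From a diagonal one reaches the outside of the graph by passing over a single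
edge, any side of its tile that is a boundary edge; so the diagonal is enclosed if and only if such
an edge lies on the cycles. -/
def tilesEnclosed (M : Set S.Edge) : Set (Fin (S.n + 1)) :=
  {j | ∃ M₀, S.IsMinimalMatching M₀ ∧ ∃ e ∈ symmDiff M M₀, S.IsSide j e.1}

/-- The edges that are glued to each other: for a closed curve, the edges of the first and the last
tile labelled by the third side of the triangle in which the curve closes up; for a notch, the two
edges labelled by the last spoke of the hook, one on the outermost tile of the hook and one on the
tile of the first (last) crossing of the underlying plain arc. -/
def GlueEdge (e e' : S.Edge) : Prop :=
  (S.closing = some Turn.left ∧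
    e.1 = EdgeName.source Hand.right ∧ e'.1 = EdgeName.target Hand.right) ∨
  (S.closing = some Turn.right ∧
    e.1 = EdgeName.source Hand.left ∧ e'.1 = EdgeName.target Hand.left) ∨
  (∃ i ∈ S.startHook,
    e.1 = EdgeName.source Hand.right ∧ e'.1 = EdgeName.link i Hand.right Hand.left) ∨
  (∃ i ∈ S.endHook,
    e.1 = EdgeName.target Hand.left ∧ e'.1 = EdgeName.link i Hand.right Hand.left)

/-- The corresponding identification of the ends of the glued edges. -/
def GlueCorner (x x' : S.Corner) : Prop :=
  (S.closing = some Turn.left ∧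
    ((x = Corner.source ∧ x' = Corner.right (Fin.last S.n)) ∨
      (x = Corner.right 0 ∧ x' = Corner.target))) ∨
  (S.closing = some Turn.right ∧
    ((x = Corner.source ∧ x' = Corner.left (Fin.last S.n)) ∨
      (x = Corner.left 0 ∧ x' = Corner.target))) ∨
  (∃ i ∈ S.startHook,
    (x = Corner.source ∧ x' = Corner.left i.succ) ∨
      (x = Corner.right 0 ∧ x' = Corner.right i.castSucc)) ∨
  (∃ i ∈ S.endHook,
    (x = Corner.target ∧ x' = Corner.right i.castSucc) ∨
      (x = Corner.left (Fin.last S.n) ∧ x' = Corner.left i.succ))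

/-- The snake graph with hexagonal tiles: for a plain arc nothing is glued; for a closed curve it is
a band graph, for a notched arc a loop graph. -/
def graph : Multigraph :=
  S.unglued.glue S.GlueCorner S.GlueEdge

/-- The perfect matching `M'` of the unglued graph extends the matching `M` of the glued graph: `M'`
is a lift of `M` together with further copies of glued edges. -/
def Extends (M : Set S.graph.E) (M' : Set S.Edge) : Prop :=
  S.unglued.IsPerfectMatching M' ∧
  (∀ e : S.Edge, (∀ e', ¬ S.GlueEdge e e' ∧ ¬ S.GlueEdge e' e) →
    (e ∈ M' ↔ Quot.mk S.GlueEdge e ∈ M)) ∧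
  ∀ e ∈ M, ∃ e' ∈ M', Quot.mk S.GlueEdge e' = e

/-- The matchings of the snake graph: its perfect matchings; for a band graph or a loop graph, the
good ones, that is, those that extend to a perfect matching of the unglued graph. -/
structure Matching where
  edges : Set S.graph.E
  isPerfectMatching : S.graph.IsPerfectMatching edges
  good : ∃ M', S.Extends edges M'

/-- The tiles enclosed by `M ⊖ M₋`. -/
def Matching.tiles {S : SnakeShape} (M : S.Matching) : Set (Fin (S.n + 1)) :=
  {j | ∃ M', S.Extends M.edges M' ∧ j ∈ S.tilesEnclosed M'}

/-! ## The poset of a curve -/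

/-- The elements of the poset: one for every crossing, and an auxiliary one for every time the curve
winds `k` times, `0 < k < p - 2`, around an orbifold point of order `p` between two crossings. -/
inductive PosetElement
  | crossing (j : Fin (S.n + 1))
  | aux (i : Fin S.n) (hex : S.turn i = Turn.hex)

/-- Auxiliary elements. -/
def PosetElement.IsAux {S : SnakeShape} : S.PosetElement → Prop
  | .crossing _ => False
  | .aux _ _ => True

/-- The generating relations `x ≼ y` of the poset: between consecutive crossings; for a closed curve
between the last and the first crossing; for a notched end between the outermost spoke crossed by
the hook and the adjacent crossing of the underlying plain arc (the passage from that spoke to the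
first crossing of the plain arc is a right turn at the start; the passage from the last crossing of
the plain arc to the last spoke is a left turn at the end). -/
inductive Generating : S.PosetElement → S.PosetElement → Prop
  | left (i : Fin S.n) : S.turn i = Turn.left → Generating (.crossing i.castSucc) (.crossing i.succ)
  | right (i : Fin S.n) : S.turn i = Turn.right →
      Generating (.crossing i.succ) (.crossing i.castSucc)
  | hexLeft (i : Fin S.n) (h : S.turn i = Turn.hex) :
      Generating (.crossing i.castSucc) (.aux i h)
  | hexRight (i : Fin S.n) (h : S.turn i = Turn.hex) :
      Generating (.crossing i.succ) (.aux i h)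
  | closeLeft : S.closing = some Turn.left →
      Generating (.crossing (Fin.last S.n)) (.crossing 0)
  | closeRight : S.closing = some Turn.right →
      Generating (.crossing 0) (.crossing (Fin.last S.n))
  | startHook (i : Fin S.n) : i ∈ S.startHook → Generating (.crossing i.succ) (.crossing 0)
  | endHook (i : Fin S.n) : i ∈ S.endHook →
      Generating (.crossing i.castSucc) (.crossing (Fin.last S.n))

/-- The order of the poset: the reflexive transitive closure of the generating relations. -/
instance : Preorder S.PosetElement where
  le := Relation.ReflTransGen S.Generating
  le_refl _ := Relation.ReflTransGen.refl
  le_trans _ _ _ := Relation.ReflTransGen.trans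

end SnakeShape

/-! Before gluing, the snake graph is a chain of diagonals. Starting from `source`, one sees that a
perfect matching covers exactly one end of each diagonal by an edge behind it and the other end by
an edge ahead of it. So a perfect matching amounts to the set `I` of diagonals whose left end is
covered from behind. The only constraint on `I` comes from the link missing at each ordinary turn:
its absence says precisely that `I` is closed downward for the fence relation at that turn. A
hexagonal tile has all four links and imposes nothing, just as an auxiliary element imposes nothing
on its two lower neighbours. The empty set gives the minimal matching, and the diagonals enclosed by
`M ⊖ M₋` are those in `I` (`exists_eq_matchingOf`, `isMinimalMatching_iff`,
`tilesEnclosed_matchingOf`).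

Gluing adds one condition per glued pair of edges. Good matchings of the glued graph correspond to
perfect matchings of the unglued graph that contain at least one copy of every glued edge (section
`Handles`). Expressed through `I`, this is the extra relation of a band or a hook (`isIdeal_iff`).
Since auxiliary elements are maximal, omitting them does not affect the order among crossings. Hence
matchings ordered by enclosed tiles are the lower sets of the finite poset of crossings, and
Birkhoff's theorem gives the lattice and its join-irreducibles.

Antisymmetry comes from an integer rank that strictly increases along the generating relations
between crossings. For a closed curve it exists because some turn differs from the closing one; for
hooks the step sizes are chosen so that the extra relations are respected. -/

/-! ### Perfect matchings of a graph with pairs of edges glued -/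

/-- Identifying the two members of each pair of a disjoint family of pairs changes nothing else. -/
theorem quot_mk_eq_iff_of_pairs {α ι : Type*} {r : α → α → Prop} {f : ι → Bool → α}
    (hf : ∀ i s j t, f i s = f j t → i = j ∧ s = t)
    (hr : ∀ a b, r a b ↔ ∃ i, a = f i false ∧ b = f i true) {a b : α} :
    Quot.mk r a = Quot.mk r b ↔ a = b ∨ ∃ i s, a = f i s ∧ b = f i (!s) := by
  constructor
  · intro h
    have hequiv : Equivalence fun a b : α => a = b ∨ ∃ i s, a = f i s ∧ b = f i (!s) := by
      refine ⟨fun _ => Or.inl rfl, ?_, ?_⟩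
      · rintro a b (rfl | ⟨i, s, rfl, rfl⟩)
        · exact Or.inl rfl
        · exact Or.inr ⟨i, !s, rfl, by simp⟩
      · rintro a b c (rfl | ⟨i, s, rfl, rfl⟩) (rfl | ⟨j, t, h, rfl⟩)
        · exact Or.inl rfl
        · exact Or.inr ⟨j, t, h, rfl⟩
        · exact Or.inr ⟨i, s, rfl, rfl⟩
        · obtain ⟨rfl, rfl⟩ := hf _ _ _ _ h
          exact Or.inl (by simp)
    refine hequiv.eqvGen_iff.1 ((Quot.eqvGen_exact h).mono fun x y hxy => ?_)
    obtain ⟨i, rfl, rfl⟩ := (hr x y).1 hxy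
    exact Or.inr ⟨i, false, rfl, rfl⟩
  · have key (i : ι) : Quot.mk r (f i false) = Quot.mk r (f i true) :=
      Quot.sound ((hr _ _).2 ⟨i, rfl, rfl⟩)
    rintro (rfl | ⟨i, s, rfl, rfl⟩)
    · rfl
    · cases s
      · exact key i
      · exact (key i).symm

namespace Multigraph

theorem glue_inc_mk {G : Multigraph} {rV : G.V → G.V → Prop} {rE : G.E → G.E → Prop} {x : G.V}
    {e : G.E} (h : G.inc x e) : (G.glue rV rE).inc (Quot.mk _ x) (Quot.mk _ e) :=
  ⟨x, e, rfl, rfl, h⟩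

/-- A description of the relations `rV`, `rE` by which vertices and edges are glued: pairs of edges
`edge k false`, `edge k true` are glued to each other, together with their ends, and no two of the
edges involved have an end in common. -/
structure Handles (G : Multigraph) (rV : G.V → G.V → Prop) (rE : G.E → G.E → Prop)
    (K : Type*) where
  edge : K → Bool → G.E
  corner : K → Bool → Bool → G.V
  inc_edge : ∀ x k s, G.inc x (edge k s) ↔ ∃ t, x = corner k s t
  corner_inj : ∀ k s t k' s' t', corner k s t = corner k' s' t' → k = k' ∧ s = s' ∧ t = t'
  cornerRel_iff : ∀ x x', rV x x' ↔ ∃ k t, x = corner k false t ∧ x' = corner k true t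
  edgeRel_iff : ∀ e e', rE e e' ↔ ∃ k, e = edge k false ∧ e' = edge k true
  not_inc : ∀ k e, G.inc (corner k false false) e → ¬ G.inc (corner k true false) e

namespace Handles

variable {G : Multigraph} {rV : G.V → G.V → Prop} {rE : G.E → G.E → Prop} {K : Type*}
  (H : G.Handles rV rE K)

/-- The set of edges of the glued graph all of whose copies belong to `M`. -/
def descend (_H : G.Handles rV rE K) (M : Set G.E) : Set (G.glue rV rE).E := {e | ∀ e', Quot.mk rE e' = e → e' ∈ M}

/-- The set `M'` of edges extends the set `M` of edges of the glued graph. -/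
def IsExtension (H : G.Handles rV rE K) (M : Set (G.glue rV rE).E) (M' : Set G.E) : Prop :=
  G.IsPerfectMatching M' ∧
  (∀ e, (∀ k s, e ≠ H.edge k s) → (e ∈ M' ↔ Quot.mk rE e ∈ M)) ∧
  ∀ e ∈ M, ∃ e' ∈ M', Quot.mk rE e' = e

theorem inc_corner_edge (k : K) (s t : Bool) : G.inc (H.corner k s t) (H.edge k s) :=
  (H.inc_edge _ _ _).2 ⟨t, rfl⟩

theorem eq_of_inc_corner_edge {k k' : K} {s s' t : Bool}
    (h : G.inc (H.corner k s t) (H.edge k' s')) : k = k' ∧ s = s' := by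
  obtain ⟨t', h⟩ := (H.inc_edge _ _ _).1 h
  have := H.corner_inj _ _ _ _ _ _ h
  exact ⟨this.1, this.2.1⟩

theorem edge_inj {k k' : K} {s s' : Bool} (h : H.edge k s = H.edge k' s') : k = k' ∧ s = s' :=
  H.eq_of_inc_corner_edge (h ▸ H.inc_corner_edge k s true)

theorem mk_edge_eq_iff {e e' : G.E} : Quot.mk rE e = Quot.mk rE e' ↔
    e = e' ∨ ∃ k s, e = H.edge k s ∧ e' = H.edge k (!s) :=
  quot_mk_eq_iff_of_pairs (fun _ _ _ _ => H.edge_inj) H.edgeRel_iff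

theorem mk_corner_eq_iff {x x' : G.V} : Quot.mk rV x = Quot.mk rV x' ↔
    x = x' ∨ ∃ k s t, x = H.corner k s t ∧ x' = H.corner k (!s) t := by
  refine (quot_mk_eq_iff_of_pairs (ι := K × Bool) (f := fun i s => H.corner i.1 s i.2) ?_ ?_).trans
    ?_
  · rintro ⟨k, t⟩ s ⟨k', t'⟩ s' h
    obtain ⟨rfl, rfl, rfl⟩ := H.corner_inj _ _ _ _ _ _ h
    exact ⟨rfl, rfl⟩
  · simp [H.cornerRel_iff]
  · refine or_congr_right ⟨?_, ?_⟩
    · rintro ⟨⟨k, t⟩, s, h⟩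
      exact ⟨k, s, t, h⟩
    · rintro ⟨k, s, t, h⟩
      exact ⟨⟨k, t⟩, s, h⟩

theorem mk_edge (k : K) (s s' : Bool) :
    Quot.mk rE (H.edge k s) = Quot.mk rE (H.edge k s') := by
  rw [mk_edge_eq_iff]
  by_cases h : s = s'
  · exact Or.inl (by rw [h])
  · exact Or.inr ⟨k, s, rfl, by rw [Bool.eq_not_of_ne (Ne.symm h)]⟩

theorem mk_corner (k : K) (s s' t : Bool) :
    Quot.mk rV (H.corner k s t) = Quot.mk rV (H.corner k s' t) := by
  rw [mk_corner_eq_iff]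
  by_cases h : s = s'
  · exact Or.inl (by rw [h])
  · exact Or.inr ⟨k, s, t, rfl, by rw [Bool.eq_not_of_ne (Ne.symm h)]⟩

theorem mk_eq_mk_of_ne {e e' : G.E} (he : ∀ k s, e ≠ H.edge k s)
    (h : Quot.mk rE e' = Quot.mk rE e) : e' = e := by
  rcases H.mk_edge_eq_iff.1 h with h | ⟨k, s, -, h⟩
  · exact h
  · exact absurd h (he _ _)

theorem eq_edge_of_mk {e : G.E} {k : K} {s : Bool}
    (h : Quot.mk rE e = Quot.mk rE (H.edge k s)) : ∃ s', e = H.edge k s' := by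
  rcases H.mk_edge_eq_iff.1 h with h | ⟨k', s', h, h'⟩
  · exact ⟨s, h⟩
  · obtain ⟨rfl, -⟩ := H.edge_inj h'
    exact ⟨s', h⟩

theorem eq_corner_of_mk {x : G.V} {k : K} {s t : Bool}
    (h : Quot.mk rV x = Quot.mk rV (H.corner k s t)) :
    ∃ s', x = H.corner k s' t := by
  rcases H.mk_corner_eq_iff.1 h with h | ⟨k', s', t', h, h'⟩
  · exact ⟨s, h⟩
  · obtain ⟨rfl, -, rfl⟩ := H.corner_inj _ _ _ _ _ _ h'
    exact ⟨s', h⟩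

theorem inc_mk_corner {k : K} {t : Bool} (s : Bool) {s' : Bool} {e : G.E}
    (h : G.inc (H.corner k s' t) e) :
    (G.glue rV rE).inc (Quot.mk _ (H.corner k s t)) (Quot.mk _ e) :=
  ⟨_, e, H.mk_corner k s' s t, rfl, h⟩

theorem mk_mem_descend {M : Set G.E} {e : G.E} (he : ∀ k s, e ≠ H.edge k s) :
    Quot.mk _ e ∈ H.descend M ↔ e ∈ M :=
  ⟨fun h => h _ rfl, fun h _ h' => H.mk_eq_mk_of_ne he h' ▸ h⟩

theorem mk_edge_mem_descend {M : Set G.E} {k : K} {s : Bool} :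
    Quot.mk _ (H.edge k s) ∈ H.descend M ↔ ∀ s', H.edge k s' ∈ M := by
  refine ⟨fun h s' => h _ (H.mk_edge _ _ _), fun h e' he' => ?_⟩
  obtain ⟨s', rfl⟩ := H.eq_edge_of_mk he'
  exact h s'

/-- At an end of a glued edge that does not belong to `M`, the edge in `M` is not glued. -/
theorem ne_edge_of_inc {M : Set G.E} {k : K} {s t : Bool} (hk : H.edge k s ∉ M) {e : G.E}
    (he : e ∈ M) (hinc : G.inc (H.corner k s t) e) (k' : K) (s' : Bool) : e ≠ H.edge k' s' := by
  rintro rfl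
  obtain ⟨rfl, rfl⟩ := H.eq_of_inc_corner_edge hinc
  exact hk he

/-- A perfect matching that contains a copy of every glued edge descends to the glued graph. -/
theorem isPerfectMatching_descend {M : Set G.E} (hM : G.IsPerfectMatching M)
    (hk : ∀ k, ∃ s, H.edge k s ∈ M) : (G.glue rV rE).IsPerfectMatching (H.descend M) := by
  rintro ⟨x⟩
  by_cases hx : ∃ k s t, x = H.corner k s t
  · obtain ⟨k, s, t, rfl⟩ := hx
    by_cases hall : ∀ s', H.edge k s' ∈ M
    · refine ⟨Quot.mk _ (H.edge k s), ⟨H.mk_edge_mem_descend.2 hall,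
        glue_inc_mk (H.inc_corner_edge k s t)⟩, ?_⟩
      rintro E ⟨hE, x₀, e₀, hx₀, rfl, hinc⟩
      obtain ⟨s', rfl⟩ := H.eq_corner_of_mk hx₀
      rw [(hM _).unique ⟨hE _ rfl, hinc⟩ ⟨hall s', H.inc_corner_edge k s' t⟩]
      exact H.mk_edge _ _ _
    -- Exactly one copy of the glued edge is in `M`. At the copy `s₁`, where it is absent, an
    -- unglued edge covers the corner and survives to cover the glued vertex. At the other copy the
    -- corner is covered by the glued edge, which does not descend because its partner is missing.
    · obtain ⟨s₁, hs₁⟩ := not_forall.1 hall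
      obtain ⟨s₀, hs₀⟩ := hk k
      obtain ⟨e, ⟨heM, he⟩, heu⟩ := hM (H.corner k s₁ t)
      have hne := H.ne_edge_of_inc hs₁ heM he
      refine ⟨Quot.mk _ e, ⟨(H.mk_mem_descend hne).2 heM, H.inc_mk_corner s he⟩, ?_⟩
      rintro E ⟨hE, x₀, e₀, hx₀, rfl, hinc⟩
      obtain ⟨s', rfl⟩ := H.eq_corner_of_mk hx₀
      by_cases hs' : s' = s₁
      · subst hs'
        rw [heu _ ⟨hE _ rfl, hinc⟩]
      · have h01 : s₀ ≠ s₁ := by rintro rfl; exact hs₁ hs₀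
        have h0 : s' = s₀ := by
          rw [Bool.eq_not_of_ne hs', Bool.eq_not_of_ne h01]
        subst h0
        have := (hM _).unique ⟨hE _ rfl, hinc⟩ ⟨hs₀, H.inc_corner_edge k s' t⟩
        subst this
        exact absurd (hE _ (H.mk_edge k s₁ s')) hs₁
  · obtain ⟨e, ⟨heM, he⟩, heu⟩ := hM x
    have hne : ∀ k s, e ≠ H.edge k s := by
      rintro k s rfl
      obtain ⟨t, ht⟩ := (H.inc_edge _ _ _).1 he
      exact hx ⟨k, s, t, ht⟩
    refine ⟨Quot.mk _ e, ⟨(H.mk_mem_descend hne).2 heM, glue_inc_mk he⟩, ?_⟩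
    rintro E ⟨hE, x₀, e₀, hx₀, rfl, hinc⟩
    rcases H.mk_corner_eq_iff.1 hx₀ with rfl | ⟨k, s, t, -, h⟩
    · rw [heu _ ⟨hE _ rfl, hinc⟩]
    · exact absurd ⟨_, _, _, h⟩ hx

theorem isExtension_descend {M : Set G.E} (hM : G.IsPerfectMatching M) :
    H.IsExtension (H.descend M) M := by
  refine ⟨hM, fun e he => (H.mk_mem_descend he).symm, ?_⟩
  rintro ⟨e⟩ he
  exact ⟨e, he _ rfl, rfl⟩

variable {H}

/-- If neither copy were used, the two copies of one end would be covered by unglued edges. Both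
images lie in `M` and meet the same glued vertex, so the edges coincide, against `not_inc`. -/
theorem IsExtension.exists_edge_mem {M : Set (G.glue rV rE).E} {M' : Set G.E}
    (hM : (G.glue rV rE).IsPerfectMatching M) (h : H.IsExtension M M') (k : K) :
    ∃ s, H.edge k s ∈ M' := by
  by_contra! hk
  have key (s : Bool) : ∃ e, (∀ k s, e ≠ H.edge k s) ∧ G.inc (H.corner k s false) e ∧
      Quot.mk rE e ∈ M := by
    obtain ⟨e, ⟨heM, he⟩, -⟩ := h.1 (H.corner k s false)
    have hne := H.ne_edge_of_inc (hk s) heM he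
    exact ⟨e, hne, he, (h.2.1 e hne).1 heM⟩
  obtain ⟨e, hne, hinc, he⟩ := key false
  obtain ⟨e', -, hinc', he'⟩ := key true
  have := H.mk_eq_mk_of_ne hne ((hM (Quot.mk _ (H.corner k true false))).unique
    ⟨he', glue_inc_mk hinc'⟩ ⟨he, H.inc_mk_corner _ hinc⟩)
  subst this
  exact H.not_inc _ _ hinc hinc'

/-- An edge of `M` obtained by gluing has both copies in `M'`: otherwise an unglued edge of `M'` at
an end of the missing copy would be a second edge of `M` at the glued vertex. Conversely, if both
copies are in `M'`, the edge of `M` at their common end lifts to an edge of `M'` there, which must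
be one of the copies. -/
theorem IsExtension.eq_descend {M : Set (G.glue rV rE).E} {M' : Set G.E}
    (hM : (G.glue rV rE).IsPerfectMatching M) (h : H.IsExtension M M') : M = H.descend M' := by
  have hsub : M ⊆ H.descend M' := by
    intro E hE
    obtain ⟨e, he, rfl⟩ := h.2.2 E hE
    by_cases hne : ∀ k s, e ≠ H.edge k s
    · exact (H.mk_mem_descend hne).2 he
    · push Not at hne
      obtain ⟨k, s, rfl⟩ := hne
      refine H.mk_edge_mem_descend.2 ?_
      by_contra! hs
      obtain ⟨s', hs'⟩ := hs
      obtain ⟨e, ⟨heM, he'⟩, -⟩ := h.1 (H.corner k s' true)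
      have hne := H.ne_edge_of_inc hs' heM he'
      exact hne k s (H.mk_eq_mk_of_ne hne ((hM (Quot.mk _ (H.corner k s' true))).unique
        ⟨hE, H.inc_mk_corner _ (H.inc_corner_edge k s true)⟩
        ⟨(h.2.1 e hne).1 heM, glue_inc_mk he'⟩)).symm
  refine hsub.antisymm ?_
  rintro ⟨e⟩ hE
  by_cases hne : ∀ k s, e ≠ H.edge k s
  · exact (h.2.1 e hne).1 ((H.mk_mem_descend hne).1 hE)
  · push Not at hne
    obtain ⟨k, s, rfl⟩ := hne
    obtain ⟨E', ⟨hE', x₀, e₀, hx₀, rfl, hinc⟩, -⟩ := hM (Quot.mk _ (H.corner k s true))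
    obtain ⟨s', rfl⟩ := H.eq_corner_of_mk hx₀
    have := (h.1 _).unique ⟨hsub hE' _ rfl, hinc⟩
      ⟨H.mk_edge_mem_descend.1 hE s', H.inc_corner_edge k s' true⟩
    subst this
    exact (H.mk_edge k s s') ▸ hE'

/-- Unglued edges are read off from the descended set. If a glued edge were in `N` but not in `N'`,
then `N'` would cover its end by an unglued edge; that edge would also be in `N`, giving two edges
of `N` at one corner. -/
theorem eq_of_descend_eq {M M' : Set G.E} (hM : G.IsPerfectMatching M)
    (hM' : G.IsPerfectMatching M') (h : H.descend M = H.descend M') : M = M' := by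
  have key (N N' : Set G.E) (hN' : G.IsPerfectMatching N') (hN : G.IsPerfectMatching N)
      (h : H.descend N = H.descend N') : N ⊆ N' := by
    intro e he
    by_cases hne : ∀ k s, e ≠ H.edge k s
    · rwa [← H.mk_mem_descend hne, ← h, H.mk_mem_descend hne]
    · push Not at hne
      obtain ⟨k, s, rfl⟩ := hne
      by_contra hs
      obtain ⟨e, ⟨heM, hinc⟩, -⟩ := hN' (H.corner k s true)
      have hne := H.ne_edge_of_inc hs heM hinc
      rw [← H.mk_mem_descend hne, ← h, H.mk_mem_descend hne] at heM
      exact hne _ _ ((hN _).unique ⟨heM, hinc⟩ ⟨he, H.inc_corner_edge k s true⟩)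
  exact (key M M' hM' hM h).antisymm (key M' M hM hM' h.symm)

end Handles

end Multigraph

/-! ### Perfect matchings of the unglued snake graph -/

/-- The opposite end of a crossed arc. -/
def Hand.flip : Hand → Hand
  | left => right
  | right => left

@[simp] theorem Hand.flip_left : Hand.left.flip = Hand.right := rfl

@[simp] theorem Hand.flip_right : Hand.right.flip = Hand.left := rfl

theorem Hand.ne_iff_eq_flip {x y : Hand} : x ≠ y ↔ x = y.flip := by
  cases x <;> cases y <;> simp

namespace SnakeShape

variable (S : SnakeShape)

theorem corner_inj {S : SnakeShape} {x y : Hand} {i j : Fin (S.n + 1)} :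
    S.corner x i = S.corner y j ↔ x = y ∧ i = j := by
  cases x <;> cases y <;> simp [corner]

theorem exists_eq_corner {S : SnakeShape} (x : S.Corner) :
    x = .source ∨ x = .target ∨ ∃ h j, x = S.corner h j := by
  rcases x with _ | _ | j | j
  · exact Or.inl rfl
  · exact Or.inr (Or.inl rfl)
  · exact Or.inr (Or.inr ⟨.left, j, rfl⟩)
  · exact Or.inr (Or.inr ⟨.right, j, rfl⟩)

/-- The end on the given side of the `j`-th diagonal belongs to the edge, and the edge lies on the
side of the diagonal that the curve comes from. -/
def Behind (x : Hand) (j : Fin (S.n + 1)) : S.EdgeName → Prop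
  | .source y => y = x ∧ j = 0
  | .target _ => False
  | .link i _ y => y = x ∧ j = i.succ

/-- The end on the given side of the `j`-th diagonal belongs to the edge, and the edge lies on the
side of the diagonal that the curve goes to. -/
def Ahead (x : Hand) (j : Fin (S.n + 1)) : S.EdgeName → Prop
  | .source _ => False
  | .target y => y = x ∧ j = Fin.last S.n
  | .link i y _ => y = x ∧ j = i.castSucc

variable {S}

theorem inc_corner_iff {x : Hand} {j : Fin (S.n + 1)} {e : S.EdgeName} :
    S.Inc (S.corner x j) e ↔ S.Behind x j e ∨ S.Ahead x j e := by
  rcases e with y | y | ⟨i, y, z⟩ <;> simp only [Inc, Behind, Ahead, corner_inj] <;>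
    cases x <;> cases y <;> simp [corner] <;> tauto

theorem inc_source_iff {e : S.EdgeName} : S.Inc .source e ↔ ∃ x, e = .source x := by
  rcases e with y | y | ⟨i, y, z⟩ <;> (try cases y) <;> (try cases z) <;> simp [Inc, corner]

theorem inc_target_iff {e : S.EdgeName} : S.Inc .target e ↔ ∃ x, e = .target x := by
  rcases e with y | y | ⟨i, y, z⟩ <;> (try cases y) <;> (try cases z) <;> simp [Inc, corner]

theorem behind_not_ahead {x : Hand} {j : Fin (S.n + 1)} {e : S.EdgeName} (h : S.Behind x j e) :
    ¬ S.Ahead x j e := by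
  rcases e with y | y | ⟨i, y, z⟩ <;> simp_all [Behind, Ahead]
  intro _ h'
  simp [Fin.ext_iff] at h'

/-- A set of diagonals that contains, for every left turn, the diagonal before it with the one after
it, and for every right turn the diagonal after it with the one before it. -/
def IsAdmissible (S : SnakeShape) (I : Set (Fin (S.n + 1))) : Prop :=
  ∀ i : Fin S.n, (S.turn i = .left → i.succ ∈ I → i.castSucc ∈ I) ∧
    (S.turn i = .right → i.castSucc ∈ I → i.succ ∈ I)

open Classical in
/-- The end of the `j`-th diagonal that is matched by an edge behind the diagonal. -/
noncomputable def backHand (I : Set (Fin (S.n + 1))) (j : Fin (S.n + 1)) : Hand :=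
  if j ∈ I then .left else .right

theorem backHand_eq_left {I : Set (Fin (S.n + 1))} {j : Fin (S.n + 1)} :
    backHand I j = .left ↔ j ∈ I := by
  unfold backHand; split <;> simp_all

theorem backHand_eq_right {I : Set (Fin (S.n + 1))} {j : Fin (S.n + 1)} :
    backHand I j = .right ↔ j ∉ I := by
  unfold backHand; split <;> simp_all

/-- The edges of the perfect matching that differs from the minimal one around the diagonals in `I`.
-/
def Uses (I : Set (Fin (S.n + 1))) : S.EdgeName → Prop
  | .source x => x = backHand I 0
  | .target x => x = (backHand I (Fin.last S.n)).flip
  | .link i x y => x = (backHand I i.castSucc).flip ∧ y = backHand I i.succ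

/-- The perfect matching that differs from the minimal one around the diagonals in `I`. -/
def matchingOf (I : Set (Fin (S.n + 1))) : Set S.Edge := {e | Uses I e.1}

/-- The link between the left ends is called for exactly when `i.succ ∈ I` and `i.castSucc ∉ I`, the
one between the right ends in the opposite case. These are the links missing at a left and at a
right turn, respectively. -/
theorem isAdmissible_iff {I : Set (Fin (S.n + 1))} : S.IsAdmissible I ↔
    ∀ i : Fin S.n, S.IsEdge (.link i (backHand I i.castSucc).flip (backHand I i.succ)) := by
  refine forall_congr' fun i => ?_
  by_cases h : i.castSucc ∈ I <;> by_cases h' : i.succ ∈ I <;>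
    simp [h, h', backHand, IsEdge]

theorem IsAdmissible.isEdge {I : Set (Fin (S.n + 1))} (hI : S.IsAdmissible I) {e : S.EdgeName}
    (he : Uses I e) : S.IsEdge e := by
  rcases e with y | y | ⟨i, y, z⟩
  · trivial
  · trivial
  · obtain ⟨rfl, rfl⟩ := he
    exact isAdmissible_iff.1 hI i

/-- This holds at the level of edge names for every `I`; admissibility is needed only for the named
edges to be present. -/
theorem existsUnique_uses (I : Set (Fin (S.n + 1))) (x : S.Corner) :
    ∃! e, Uses I e ∧ S.Inc x e := by
  rcases exists_eq_corner x with rfl | rfl | ⟨x, j, rfl⟩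
  · simp only [inc_source_iff]
    refine ⟨.source (backHand I 0), ⟨rfl, _, rfl⟩, ?_⟩
    rintro _ ⟨h, y, rfl⟩
    rw [show y = _ from h]
  · simp only [inc_target_iff]
    refine ⟨.target (backHand I (Fin.last S.n)).flip, ⟨rfl, _, rfl⟩, ?_⟩
    rintro _ ⟨h, y, rfl⟩
    rw [show y = _ from h]
  · simp only [inc_corner_iff]
    by_cases hx : x = backHand I j
    · have hnot {e : S.EdgeName} (h : Uses I e) : ¬ S.Ahead x j e := by
        subst hx
        rcases e with y | y | ⟨i, y, z⟩ <;> simp only [Uses, Ahead, not_false_eq_true] at h ⊢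
        · rintro ⟨rfl, rfl⟩
          exact Hand.ne_iff_eq_flip.2 h rfl
        · rintro ⟨rfl, rfl⟩
          exact Hand.ne_iff_eq_flip.2 h.1 rfl
      subst hx
      cases j using Fin.cases with
      | zero =>
        refine ⟨.source (backHand I 0), ⟨rfl, Or.inl ⟨rfl, rfl⟩⟩, ?_⟩
        rintro e ⟨he, h⟩
        replace h := h.resolve_right (hnot he)
        rcases e with y | y | ⟨i, y, z⟩
        · rw [h.1]
        · exact h.elim
        · exact absurd h.2.symm (Fin.succ_ne_zero i)
      | succ i =>
        refine ⟨.link i (backHand I i.castSucc).flip (backHand I i.succ),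
          ⟨⟨rfl, rfl⟩, Or.inl ⟨rfl, rfl⟩⟩, ?_⟩
        rintro e ⟨he, h⟩
        replace h := h.resolve_right (hnot he)
        rcases e with y | y | ⟨i', y, z⟩
        · exact absurd h.2 (Fin.succ_ne_zero i)
        · exact h.elim
        · obtain rfl := Fin.succ_injective _ h.2
          rw [he.1, he.2]
    · have hnot {e : S.EdgeName} (h : Uses I e) : ¬ S.Behind x j e := by
        rcases e with y | y | ⟨i, y, z⟩ <;> simp only [Uses, Behind, not_false_eq_true] at h ⊢
        · rintro ⟨rfl, rfl⟩
          exact hx h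
        · rintro ⟨rfl, rfl⟩
          exact hx h.2
      rw [← ne_eq, Hand.ne_iff_eq_flip] at hx
      subst hx
      cases j using Fin.lastCases with
      | last =>
        refine ⟨.target (backHand I (Fin.last S.n)).flip, ⟨rfl, Or.inr ⟨rfl, rfl⟩⟩, ?_⟩
        rintro e ⟨he, h⟩
        replace h := h.resolve_left (hnot he)
        rcases e with y | y | ⟨i, y, z⟩
        · exact h.elim
        · rw [h.1]
        · exact absurd h.2.symm (Fin.castSucc_ne_last i)
      | cast i =>
        refine ⟨.link i (backHand I i.castSucc).flip (backHand I i.succ),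
          ⟨⟨rfl, rfl⟩, Or.inr ⟨rfl, rfl⟩⟩, ?_⟩
        rintro e ⟨he, h⟩
        replace h := h.resolve_left (hnot he)
        rcases e with y | y | ⟨i', y, z⟩
        · exact h.elim
        · exact absurd h.2 (Fin.castSucc_ne_last i)
        · obtain rfl := Fin.castSucc_injective _ h.2
          rw [he.1, he.2]

theorem IsAdmissible.isPerfectMatching {I : Set (Fin (S.n + 1))} (hI : S.IsAdmissible I) :
    S.unglued.IsPerfectMatching (matchingOf I) := by
  intro x
  obtain ⟨e, ⟨he, hx⟩, hu⟩ := existsUnique_uses I x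
  exact ⟨⟨e, hI.isEdge he⟩, ⟨he, hx⟩, fun e' h => Subtype.ext (hu _ h)⟩

/-- Induction along the chain. If `x` is the only end of a diagonal covered from behind, the other
end must be covered from ahead, by a link to the next diagonal. Any link of `M` between the two
diagonals starts at that other end, so there is only one, and it reaches only one end of the next
diagonal. -/
theorem exists_hand_of_isPerfectMatching {M : Set S.Edge} (hM : S.unglued.IsPerfectMatching M)
    (j : Fin (S.n + 1)) :
    ∃ x, (∃ e ∈ M, S.Behind x j e.1) ∧ ∀ e ∈ M, ¬ S.Behind x.flip j e.1 := by
  induction j using Fin.induction with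
  | zero =>
    obtain ⟨e, ⟨he, hinc⟩, hu⟩ := hM Corner.source
    obtain ⟨x, hx⟩ := inc_source_iff.1 hinc
    refine ⟨x, ⟨e, he, by rw [hx]; exact ⟨rfl, rfl⟩⟩, ?_⟩
    rintro e' he' h
    have h' : e'.1 = .source x.flip := by
      rcases hy : e'.1 with y | y | ⟨i, y, z⟩ <;> rw [hy] at h
      · rw [h.1]
      · exact h.elim
      · exact absurd h.2.symm (Fin.succ_ne_zero i)
    have := hu e' ⟨he', inc_source_iff.2 ⟨_, h'⟩⟩
    rw [this, hx] at h'
    simp only [EdgeName.source.injEq] at h'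
    exact Hand.ne_iff_eq_flip.2 h' rfl
  | succ i ih =>
    obtain ⟨x, ⟨e, he, hx⟩, hflip⟩ := ih
    have hahead {y y' : Hand} {e : S.Edge} (he : e ∈ M) (h : e.1 = .link i y y') :
        y = x.flip := by
      rw [← Hand.ne_iff_eq_flip]
      rintro rfl
      have ha : S.Ahead y i.castSucc e.1 := by rw [h]; exact ⟨rfl, rfl⟩
      have := (hM (S.corner y i.castSucc)).unique ⟨he, inc_corner_iff.2 (Or.inr ha)⟩
        ⟨‹_›, inc_corner_iff.2 (Or.inl hx)⟩
      exact behind_not_ahead hx (this ▸ ha)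
    obtain ⟨e₁, ⟨he₁, hinc⟩, hu⟩ := hM (S.corner x.flip i.castSucc)
    have h₁ := (inc_corner_iff.1 hinc).resolve_left (hflip e₁ he₁)
    obtain ⟨z, hz⟩ : ∃ z, e₁.1 = .link i x.flip z := by
      rcases hy : e₁.1 with y | y | ⟨i', y, z⟩ <;> rw [hy] at h₁
      · exact h₁.elim
      · exact absurd h₁.2 (Fin.castSucc_ne_last i)
      · obtain rfl := Fin.castSucc_injective _ h₁.2
        rw [h₁.1]
        exact ⟨z, rfl⟩
    refine ⟨z, ⟨e₁, he₁, by rw [hz]; exact ⟨rfl, rfl⟩⟩, ?_⟩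
    intro e' he' h
    obtain ⟨y, hy⟩ : ∃ y, e'.1 = .link i y z.flip := by
      rcases hy : e'.1 with y | y | ⟨i', y, z⟩ <;> rw [hy] at h
      · exact absurd h.2 (Fin.succ_ne_zero i)
      · exact h.elim
      · obtain rfl := Fin.succ_injective _ h.2
        rw [h.1]
        exact ⟨y, rfl⟩
    have hyx := hahead he' hy
    have := hu e' ⟨he', inc_corner_iff.2 (Or.inr (by rw [hy]; exact ⟨hyx, rfl⟩))⟩
    rw [this, hz] at hy
    simp only [EdgeName.link.injEq] at hy
    exact Hand.ne_iff_eq_flip.2 hy.2.2 rfl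

/-- Every perfect matching of the unglued graph is given by an admissible set of diagonals. -/
theorem exists_eq_matchingOf {M : Set S.Edge} (hM : S.unglued.IsPerfectMatching M) :
    ∃ I, S.IsAdmissible I ∧ M = matchingOf I := by
  choose h hB hF using exists_hand_of_isPerfectMatching hM
  have hback (j : Fin (S.n + 1)) : backHand {j | h j = .left} j = h j := by
    cases hj : h j <;> simp [backHand, hj]
  have behind {x : Hand} {j : Fin (S.n + 1)} {e : S.Edge} (he : e ∈ M)
      (hx : S.Behind x j e.1) : x = h j := by
    by_contra hne
    exact hF j e he (Hand.ne_iff_eq_flip.1 hne ▸ hx)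
  have ahead {x : Hand} {j : Fin (S.n + 1)} {e : S.Edge} (he : e ∈ M)
      (hx : S.Ahead x j e.1) : x = (h j).flip := by
    rw [← Hand.ne_iff_eq_flip]
    rintro rfl
    obtain ⟨e', he', hx'⟩ := hB j
    have := (hM (S.corner (h j) j)).unique ⟨he, inc_corner_iff.2 (Or.inr hx)⟩
      ⟨he', inc_corner_iff.2 (Or.inl hx')⟩
    exact behind_not_ahead hx' (this ▸ hx)
  have hlink (i : Fin S.n) : ∃ e ∈ M, e.1 = .link i (h i.castSucc).flip (h i.succ) := by
    obtain ⟨e, he, hx⟩ := hB i.succ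
    refine ⟨e, he, ?_⟩
    rcases hy : e.1 with y | y | ⟨i', y, z⟩ <;> rw [hy] at hx
    · exact absurd hx.2 (Fin.succ_ne_zero i)
    · exact hx.elim
    · obtain rfl := Fin.succ_injective _ hx.2
      rw [hx.1, ahead he (x := y) (j := i.castSucc) (by rw [hy]; exact ⟨rfl, rfl⟩)]
  refine ⟨{j | h j = .left}, ?_, ?_⟩
  · rw [isAdmissible_iff]
    intro i
    obtain ⟨e, -, he⟩ := hlink i
    rw [hback, hback, ← he]
    exact e.2
  · ext e
    change e ∈ M ↔ Uses _ e.1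
    constructor
    · intro he
      rcases hy : e.1 with y | y | ⟨i, y, z⟩ <;> simp only [Uses, hback]
      · exact behind he (by rw [hy]; exact ⟨rfl, rfl⟩)
      · exact ahead he (by rw [hy]; exact ⟨rfl, rfl⟩)
      · exact ⟨ahead he (by rw [hy]; exact ⟨rfl, rfl⟩), behind he (by rw [hy]; exact ⟨rfl, rfl⟩)⟩
    · intro hu
      rcases hy : e.1 with y | y | ⟨i, y, z⟩ <;> simp only [hy, Uses, hback] at hu
      · obtain ⟨e', he', hx⟩ := hB 0
        rcases hy' : e'.1 with y' | y' | ⟨i, y', z⟩ <;> rw [hy'] at hx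
        · rwa [Subtype.ext (a1 := e) (a2 := e') (by rw [hy, hy', hu, hx.1])]
        · exact hx.elim
        · exact absurd hx.2.symm (Fin.succ_ne_zero i)
      · obtain ⟨e', ⟨he', hinc⟩, -⟩ := hM (S.corner (h (Fin.last S.n)).flip (Fin.last S.n))
        have hx := (inc_corner_iff.1 hinc).resolve_left (hF _ e' he')
        rcases hy' : e'.1 with y' | y' | ⟨i, y', z⟩ <;> rw [hy'] at hx
        · exact hx.elim
        · rwa [Subtype.ext (a1 := e) (a2 := e') (by rw [hy, hy', hu, hx.1])]
        · exact absurd hx.2.symm (Fin.castSucc_ne_last i)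
      · obtain ⟨e', he', hx⟩ := hlink i
        rwa [Subtype.ext (a1 := e) (a2 := e') (by rw [hy, hx, hu.1, hu.2])]

theorem matchingOf_empty_isBoundary {e : S.EdgeName} (he : Uses (∅ : Set (Fin (S.n + 1))) e) :
    S.IsBoundary e := by
  rcases e with y | y | ⟨i, y, z⟩
  · trivial
  · trivial
  · obtain ⟨rfl, rfl⟩ := he
    simp [backHand, IsBoundary]

/-- The minimal matching is the one given by the empty set of diagonals. -/
theorem isMinimalMatching_iff {M : Set S.Edge} :
    S.IsMinimalMatching M ↔ M = matchingOf ∅ := by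
  constructor
  · rintro ⟨hM, hB, e, he, hs⟩
    obtain ⟨I, hI, rfl⟩ := exists_eq_matchingOf hM
    congr 1
    rw [Set.eq_empty_iff_forall_notMem]
    intro j
    induction j using Fin.induction with
    | zero =>
      replace he : Uses I e.1 := he
      rw [hs] at he
      exact backHand_eq_right.1 (Eq.symm he)
    | succ i ih =>
      -- A boundary link joins ends on different sides, so the side covered from behind stays the
      -- same from one diagonal to the next.
      have : S.IsBoundary (.link i (backHand I i.castSucc).flip (backHand I i.succ)) :=
        hB ⟨_, isAdmissible_iff.1 hI i⟩ ⟨rfl, rfl⟩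
      rw [← backHand_eq_right] at ih ⊢
      rw [ih] at this
      cases h : backHand I i.succ
      · simp [h, IsBoundary] at this
      · rfl
  · rintro rfl
    have hI : S.IsAdmissible ∅ := fun i => by simp
    refine ⟨hI.isPerfectMatching, fun e he => matchingOf_empty_isBoundary he,
      ⟨.source .right, trivial⟩, ?_, rfl⟩
    exact (backHand_eq_right.2 (Set.notMem_empty _)).symm

theorem mem_tilesEnclosed {M : Set S.Edge} {j : Fin (S.n + 1)} :
    j ∈ S.tilesEnclosed M ↔ ∃ e ∈ symmDiff M (matchingOf ∅), S.IsSide j e.1 := by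
  simp [tilesEnclosed, isMinimalMatching_iff]

theorem mem_symmDiff_matchingOf {I : Set (Fin (S.n + 1))} {e : S.Edge} :
    e ∈ symmDiff (matchingOf I) (matchingOf ∅) ↔
      ¬ (Uses I e.1 ↔ Uses (∅ : Set (Fin (S.n + 1))) e.1) := by
  rw [Set.mem_symmDiff]
  change (Uses I e.1 ∧ ¬ Uses _ e.1) ∨ (Uses _ e.1 ∧ ¬ Uses _ e.1) ↔ _
  tauto

/-- A side of a tile belongs to the symmetric difference with the minimal matching if and only if
the tile does. -/
theorem IsAdmissible.uses_iff_of_isSide {I : Set (Fin (S.n + 1))} (hI : S.IsAdmissible I)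
    {j : Fin (S.n + 1)} {e : S.EdgeName} (h : S.IsSide j e) :
    ¬ (Uses I e ↔ Uses (∅ : Set (Fin (S.n + 1))) e) ↔ j ∈ I := by
  rcases e with y | y | ⟨i, y, z⟩
  · obtain rfl : j = 0 := h
    by_cases h0 : 0 ∈ I <;> cases y <;> simp [Uses, backHand, h0]
  · obtain rfl : j = Fin.last S.n := h
    by_cases h0 : Fin.last S.n ∈ I <;> cases y <;> simp [Uses, backHand, h0]
  -- By admissibility each of these links depends on one diagonal only. At a left turn, for
  -- instance, the link from left to right is used if and only if `i.castSucc ∉ I`, since this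
  -- already forces `i.succ ∉ I`.
  · have hi := hI i
    cases y <;> cases z <;> simp only [IsSide] at h <;>
      rcases h with ⟨ht, rfl⟩ | ⟨ht, rfl⟩ <;>
      by_cases h0 : i.castSucc ∈ I <;> by_cases h1 : i.succ ∈ I <;>
      simp_all [Uses, backHand]

/-! ### Recovering the set of diagonals from the enclosed tiles -/

/-- No two hexagonal tiles are adjacent. -/
def NoAdjacentHex (S : SnakeShape) : Prop :=
  ∀ i j : Fin S.n, i.succ = j.castSucc → S.turn i = .hex → S.turn j ≠ .hex

theorem exists_isSide_succ {i : Fin S.n} (h : S.turn i ≠ .hex) :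
    ∃ e : S.Edge, S.IsSide i.succ e.1 := by
  rcases ht : S.turn i
  · exact ⟨⟨.link i .right .left, trivial⟩, Or.inl ⟨ht, rfl⟩⟩
  · exact ⟨⟨.link i .left .right, trivial⟩, Or.inr ⟨ht, rfl⟩⟩
  · exact absurd ht h

theorem exists_isSide_castSucc {i : Fin S.n} (h : S.turn i ≠ .hex) :
    ∃ e : S.Edge, S.IsSide i.castSucc e.1 := by
  rcases ht : S.turn i
  · exact ⟨⟨.link i .left .right, trivial⟩, Or.inl ⟨ht, rfl⟩⟩
  · exact ⟨⟨.link i .right .left, trivial⟩, Or.inr ⟨ht, rfl⟩⟩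
  · exact absurd ht h

/-- The links of a hexagonal passage are sides of no diagonal in the sense of `IsSide`. A diagonal
therefore takes its side from the passage before or after it, or from `source` or `target` at the
ends of the chain. -/
theorem NoAdjacentHex.exists_isSide (hS : S.NoAdjacentHex) (j : Fin (S.n + 1)) :
    ∃ e : S.Edge, S.IsSide j e.1 := by
  cases j using Fin.cases with
  | zero => exact ⟨⟨.source .right, trivial⟩, rfl⟩
  | succ i =>
    by_cases hi : S.turn i = .hex
    · cases hj : i.succ using Fin.lastCases with
      | last => exact ⟨⟨.target .right, trivial⟩, rfl⟩
      | cast j => exact exists_isSide_castSucc (hS i j hj hi)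
    · exact exists_isSide_succ hi

theorem NoAdjacentHex.tilesEnclosed_matchingOf (hS : S.NoAdjacentHex)
    {I : Set (Fin (S.n + 1))} (hI : S.IsAdmissible I) : S.tilesEnclosed (matchingOf I) = I := by
  ext j
  simp only [mem_tilesEnclosed, mem_symmDiff_matchingOf]
  constructor
  · rintro ⟨e, he, hs⟩
    exact (hI.uses_iff_of_isSide hs).1 he
  · intro hj
    obtain ⟨e, he⟩ := hS.exists_isSide j
    exact ⟨e, (hI.uses_iff_of_isSide he).2 hj, he⟩

end SnakeShape

/-! ### Regular shapes and their glued edges -/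

namespace SnakeShape

/-- The properties of the shape of a curve on which its snake graph and its poset depend. -/
structure IsRegular (S : SnakeShape) : Prop where
  startHook : ∀ i ∈ S.startHook, 0 < i.val ∧ S.turn i = .left ∧ ∀ k < i, S.turn k = .right
  endHook : ∀ i ∈ S.endHook, i.val + 2 ≤ S.n ∧ S.turn i = .right ∧ ∀ k > i, S.turn k = .left
  lt : ∀ i ∈ S.startHook, ∀ j ∈ S.endHook, i < j
  closing : ∀ t, S.closing = some t → t ≠ .hex ∧ S.startHook = none ∧ S.endHook = none ∧
    ∃ k, S.turn k ≠ t
  noAdjacentHex : S.NoAdjacentHex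

/-- The pairs of edges that are glued to each other. -/
inductive Handle (S : SnakeShape)
  | closeLeft (h : S.closing = some .left)
  | closeRight (h : S.closing = some .right)
  | startHook (i : Fin S.n) (h : i ∈ S.startHook)
  | endHook (i : Fin S.n) (h : i ∈ S.endHook)

variable {S : SnakeShape}

/-- The two edges that are glued to each other. -/
def Handle.edge : S.Handle → Bool → S.Edge
  | .closeLeft _, false => ⟨.source .right, trivial⟩
  | .closeLeft _, true => ⟨.target .right, trivial⟩
  | .closeRight _, false => ⟨.source .left, trivial⟩
  | .closeRight _, true => ⟨.target .left, trivial⟩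
  | .startHook _ _, false => ⟨.source .right, trivial⟩
  | .startHook i _, true => ⟨.link i .right .left, trivial⟩
  | .endHook _ _, false => ⟨.target .left, trivial⟩
  | .endHook i _, true => ⟨.link i .right .left, trivial⟩

/-- The ends of the edges that are glued to each other. -/
def Handle.corner : S.Handle → Bool → Bool → S.Corner
  | .closeLeft _, false, false => .source
  | .closeLeft _, true, false => .right (Fin.last S.n)
  | .closeLeft _, false, true => .right 0
  | .closeLeft _, true, true => .target
  | .closeRight _, false, false => .source
  | .closeRight _, true, false => .left (Fin.last S.n)
  | .closeRight _, false, true => .left 0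
  | .closeRight _, true, true => .target
  | .startHook _ _, false, false => .source
  | .startHook i _, true, false => .left i.succ
  | .startHook _ _, false, true => .right 0
  | .startHook i _, true, true => .right i.castSucc
  | .endHook _ _, false, false => .target
  | .endHook i _, true, false => .right i.castSucc
  | .endHook _ _, false, true => .left (Fin.last S.n)
  | .endHook i _, true, true => .left i.succ

theorem Handle.inc_edge (x : S.Corner) (k : S.Handle) (s : Bool) :
    S.Inc x (k.edge s).1 ↔ ∃ t, x = k.corner s t := by
  rcases k with h | h | ⟨i, h⟩ | ⟨i, h⟩ <;> cases s <;>
    simp [Handle.edge, Handle.corner, Inc, SnakeShape.corner] <;> exact or_comm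

theorem glueEdge_iff (e e' : S.Edge) :
    S.GlueEdge e e' ↔ ∃ k : S.Handle, e = k.edge false ∧ e' = k.edge true := by
  constructor
  · rintro (⟨h, h₁, h₂⟩ | ⟨h, h₁, h₂⟩ | ⟨i, h, h₁, h₂⟩ | ⟨i, h, h₁, h₂⟩)
    · exact ⟨.closeLeft h, Subtype.ext h₁, Subtype.ext h₂⟩
    · exact ⟨.closeRight h, Subtype.ext h₁, Subtype.ext h₂⟩
    · exact ⟨.startHook i h, Subtype.ext h₁, Subtype.ext h₂⟩
    · exact ⟨.endHook i h, Subtype.ext h₁, Subtype.ext h₂⟩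
  · rintro ⟨h | h | ⟨i, h⟩ | ⟨i, h⟩, rfl, rfl⟩
    · exact Or.inl ⟨h, rfl, rfl⟩
    · exact Or.inr (Or.inl ⟨h, rfl, rfl⟩)
    · exact Or.inr (Or.inr (Or.inl ⟨i, h, rfl, rfl⟩))
    · exact Or.inr (Or.inr (Or.inr ⟨i, h, rfl, rfl⟩))

theorem glueCorner_iff (x x' : S.Corner) :
    S.GlueCorner x x' ↔ ∃ (k : S.Handle) (t : Bool), x = k.corner false t ∧ x' = k.corner true t := by
  constructor
  · rintro (⟨h, h' | h'⟩ | ⟨h, h' | h'⟩ | ⟨i, h, h' | h'⟩ | ⟨i, h, h' | h'⟩)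
    · exact ⟨.closeLeft h, false, h'⟩
    · exact ⟨.closeLeft h, true, h'⟩
    · exact ⟨.closeRight h, false, h'⟩
    · exact ⟨.closeRight h, true, h'⟩
    · exact ⟨.startHook i h, false, h'⟩
    · exact ⟨.startHook i h, true, h'⟩
    · exact ⟨.endHook i h, false, h'⟩
    · exact ⟨.endHook i h, true, h'⟩
  · rintro ⟨h | h | ⟨i, h⟩ | ⟨i, h⟩, _ | _, h'⟩
    · exact Or.inl ⟨h, Or.inl h'⟩
    · exact Or.inl ⟨h, Or.inr h'⟩
    · exact Or.inr (Or.inl ⟨h, Or.inl h'⟩)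
    · exact Or.inr (Or.inl ⟨h, Or.inr h'⟩)
    · exact Or.inr (Or.inr (Or.inl ⟨i, h, Or.inl h'⟩))
    · exact Or.inr (Or.inr (Or.inl ⟨i, h, Or.inr h'⟩))
    · exact Or.inr (Or.inr (Or.inr ⟨i, h, Or.inl h'⟩))
    · exact Or.inr (Or.inr (Or.inr ⟨i, h, Or.inr h'⟩))

theorem IsRegular.pos_of_closing (hS : S.IsRegular) {t : Turn} (h : S.closing = some t) :
    0 < S.n := by
  obtain ⟨-, -, -, k, -⟩ := hS.closing t h
  exact k.pos

/-- A band needs at least two diagonals. A start hook needs `0 < i` to separate the right ends of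
diagonals `0` and `i`; an end hook needs `i + 2 ≤ n` to separate the left ends of `i + 1` and `n`.
-/
theorem IsRegular.corner_inj_self (hS : S.IsRegular) (k : S.Handle) {s t s' t' : Bool}
    (h : k.corner s t = k.corner s' t') : s = s' ∧ t = t' := by
  rcases k with hk | hk | ⟨i, hk⟩ | ⟨i, hk⟩
  · have := hS.pos_of_closing hk
    cases s <;> cases t <;> cases s' <;> cases t' <;>
      simp [Handle.corner, Fin.ext_iff] at h ⊢ <;> omega
  · have := hS.pos_of_closing hk
    cases s <;> cases t <;> cases s' <;> cases t' <;>
      simp [Handle.corner, Fin.ext_iff] at h ⊢ <;> omega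
  · have := (hS.startHook i hk).1
    cases s <;> cases t <;> cases s' <;> cases t' <;>
      simp [Handle.corner, Fin.ext_iff] at h ⊢ <;> omega
  · have := (hS.endHook i hk).1
    cases s <;> cases t <;> cases s' <;> cases t' <;>
      simp [Handle.corner, Fin.ext_iff] at h ⊢ <;> omega

theorem IsRegular.startHook_corner_ne (hS : S.IsRegular) {i j : Fin S.n} (hi : i ∈ S.startHook)
    (hj : j ∈ S.endHook) (s t s' t' : Bool) :
    (Handle.startHook i hi).corner s t ≠ (Handle.endHook j hj).corner s' t' := by
  intro h
  have h₁ := (hS.startHook i hi).1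
  have h₂ := (hS.endHook j hj).1
  have h₃ : i.val < j.val := hS.lt i hi j hj
  cases s <;> cases t <;> cases s' <;> cases t' <;>
    simp [Handle.corner, Fin.ext_iff] at h <;> omega

/-- A closing turn excludes hooks, so two distinct glued pairs can only come from a curve notched at
both ends. -/
theorem IsRegular.handle_eq_or (hS : S.IsRegular) (k k' : S.Handle) :
    k = k' ∨ ∃ i j hi hj, (k = .startHook i hi ∧ k' = .endHook j hj) ∨
      (k' = .startHook i hi ∧ k = .endHook j hj) := by
  rcases k with h | h | ⟨i, h⟩ | ⟨i, h⟩ <;> rcases k' with h' | h' | ⟨i', h'⟩ | ⟨i', h'⟩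
  any_goals first
    | exact Or.inl rfl
    | exact Or.inr ⟨i, i', h, h', Or.inl ⟨rfl, rfl⟩⟩
    | exact Or.inr ⟨i', i, h', h, Or.inr ⟨rfl, rfl⟩⟩
    | (obtain rfl := Option.mem_unique h h'; exact Or.inl rfl)
  all_goals exfalso
  · simp [h] at h'
  · simp [(hS.closing _ h).2.1] at h'
  · simp [(hS.closing _ h).2.2.1] at h'
  · simp [h] at h'
  · simp [(hS.closing _ h).2.1] at h'
  · simp [(hS.closing _ h).2.2.1] at h'
  · simp [(hS.closing _ h').2.1] at h
  · simp [(hS.closing _ h').2.1] at h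
  · simp [(hS.closing _ h').2.2.1] at h
  · simp [(hS.closing _ h').2.2.1] at h

theorem IsRegular.handle_not_inc (hS : S.IsRegular) (k : S.Handle) (e : S.EdgeName)
    (h : S.Inc (k.corner false false) e) : ¬ S.Inc (k.corner true false) e := by
  intro h'
  rcases k with hk | hk | ⟨i, hk⟩ | ⟨i, hk⟩
  · have := hS.pos_of_closing hk
    obtain ⟨y, rfl⟩ := inc_source_iff.1 h
    cases y <;> simp [Handle.corner, Inc, corner, Fin.ext_iff] at h'
    omega
  · have := hS.pos_of_closing hk
    obtain ⟨y, rfl⟩ := inc_source_iff.1 h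
    cases y <;> simp [Handle.corner, Inc, corner, Fin.ext_iff] at h'
    omega
  · obtain ⟨y, rfl⟩ := inc_source_iff.1 h
    cases y <;> simp [Handle.corner, Inc, corner, Fin.ext_iff] at h'
  · have := (hS.endHook i hk).1
    obtain ⟨y, rfl⟩ := inc_target_iff.1 h
    cases y <;> simp [Handle.corner, Inc, corner, Fin.ext_iff] at h'
    omega

/-- The gluing of the snake graph of a regular shape. -/
def IsRegular.handles (hS : S.IsRegular) :
    S.unglued.Handles S.GlueCorner S.GlueEdge S.Handle where
  edge := Handle.edge
  corner := Handle.corner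
  inc_edge := Handle.inc_edge
  cornerRel_iff := glueCorner_iff
  edgeRel_iff := glueEdge_iff
  corner_inj k s t k' s' t' h := by
    rcases hS.handle_eq_or k k' with rfl | ⟨i, j, hi, hj, ⟨rfl, rfl⟩ | ⟨rfl, rfl⟩⟩
    · exact ⟨rfl, hS.corner_inj_self k h⟩
    · exact absurd h (hS.startHook_corner_ne hi hj _ _ _ _)
    · exact absurd h.symm (hS.startHook_corner_ne hi hj _ _ _ _)
  not_inc k e := hS.handle_not_inc k e.1

end SnakeShape

/-! ### Matchings as lower sets of crossings -/

namespace SnakeShape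

variable {S : SnakeShape}

/-- The sets of crossings that are closed under passing to smaller ones. -/
def IsIdeal (S : SnakeShape) (I : Set (Fin (S.n + 1))) : Prop :=
  ∀ a b, S.Generating (.crossing a) (.crossing b) → b ∈ I → a ∈ I

theorem IsIdeal.isAdmissible {I : Set (Fin (S.n + 1))} (hI : S.IsIdeal I) : S.IsAdmissible I :=
  fun i => ⟨fun h => hI _ _ (.left i h), fun h => hI _ _ (.right i h)⟩

/-- The ideals are the sets of diagonals that give matchings of the unglued graph with a copy of
every glued edge. -/
theorem IsRegular.isIdeal_iff (hS : S.IsRegular) {I : Set (Fin (S.n + 1))} :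
    S.IsIdeal I ↔ S.IsAdmissible I ∧ ∀ k : S.Handle, ∃ s, k.edge s ∈ matchingOf I := by
  constructor
  · refine fun hI => ⟨hI.isAdmissible, ?_⟩
    rintro (h | h | ⟨i, h⟩ | ⟨i, h⟩)
    -- The source edge is used if and only if `0 ∉ I`, the target edge if and only if the last
    -- diagonal is in `I`. Having one of them is thus the closing relation.
    · by_cases h0 : 0 ∈ I
      · refine ⟨true, ?_⟩
        have := hI _ _ (.closeLeft h) h0
        simp [matchingOf, Handle.edge, Uses, backHand, this]
      · refine ⟨false, ?_⟩
        simp [matchingOf, Handle.edge, Uses, backHand, h0]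
    · by_cases h0 : 0 ∈ I
      · refine ⟨false, ?_⟩
        simp [matchingOf, Handle.edge, Uses, backHand, h0]
      · refine ⟨true, ?_⟩
        have := mt (hI _ _ (.closeRight h)) h0
        simp [matchingOf, Handle.edge, Uses, backHand, this]
    -- The glued link is used when both `i.castSucc` and `i.succ` are in `I`. As the turn at `i` is
    -- left, the second membership implies the first, so only the hook relation is left. At an end
    -- hook the turn is right and the roles are exchanged.
    · by_cases h0 : 0 ∈ I
      · refine ⟨true, ?_⟩
        have h1 := hI _ _ (.startHook i h) h0
        have h2 := hI _ _ (.left i (hS.startHook i h).2.1) h1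
        simp [matchingOf, Handle.edge, Uses, backHand, h1, h2]
      · refine ⟨false, ?_⟩
        simp [matchingOf, Handle.edge, Uses, backHand, h0]
    · by_cases h0 : Fin.last S.n ∈ I
      · refine ⟨true, ?_⟩
        have h1 := hI _ _ (.endHook i h) h0
        have h2 := hI _ _ (.right i (hS.endHook i h).2.1) h1
        simp [matchingOf, Handle.edge, Uses, backHand, h1, h2]
      · refine ⟨false, ?_⟩
        simp [matchingOf, Handle.edge, Uses, backHand, h0]
  · rintro ⟨hI, hk⟩ a b hab hb
    cases hab with
    | left i h => exact (hI i).1 h hb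
    | right i h => exact (hI i).2 h hb
    | closeLeft h =>
      by_contra h'
      obtain ⟨_ | _, hs⟩ := hk (.closeLeft h) <;>
        simp [matchingOf, Handle.edge, Uses, backHand, hb, h'] at hs
    | closeRight h =>
      by_contra h'
      obtain ⟨_ | _, hs⟩ := hk (.closeRight h) <;>
        simp [matchingOf, Handle.edge, Uses, backHand, hb, h'] at hs
    | startHook i h =>
      obtain ⟨_ | _, hs⟩ := hk (.startHook i h)
      · simp [matchingOf, Handle.edge, Uses, backHand, hb] at hs
      · exact backHand_eq_left.1 hs.2.symm
    | endHook i h =>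
      obtain ⟨_ | _, hs⟩ := hk (.endHook i h)
      · simp [matchingOf, Handle.edge, Uses, backHand, hb] at hs
      · by_contra h'
        simp [matchingOf, Handle.edge, Uses, backHand, h'] at hs

theorem IsRegular.extends_iff (hS : S.IsRegular) {M : Set S.graph.E} {M' : Set S.Edge} :
    S.Extends M M' ↔ hS.handles.IsExtension M M' := by
  refine and_congr_right fun _ => and_congr_left fun _ => forall_congr' fun e => ?_
  refine imp_congr_left ⟨?_, ?_⟩
  · rintro h k (_ | _) rfl
    · exact (h (k.edge true)).1 ((glueEdge_iff _ _).2 ⟨k, rfl, rfl⟩)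
    · exact (h (k.edge false)).2 ((glueEdge_iff _ _).2 ⟨k, rfl, rfl⟩)
  · refine fun h e' => ⟨fun h' => ?_, fun h' => ?_⟩
    · obtain ⟨k, h', -⟩ := (glueEdge_iff _ _).1 h'
      exact h k false h'
    · obtain ⟨k, -, h'⟩ := (glueEdge_iff _ _).1 h'
      exact h k true h'

/-- Every matching descends from the matching of the unglued graph given by the ideal of its tiles.
-/
theorem IsRegular.matching_eq (hS : S.IsRegular) (M : S.Matching) :
    S.IsIdeal M.tiles ∧ M.edges = hS.handles.descend (matchingOf M.tiles) := by
  have key (M' : Set S.Edge) (h : S.Extends M.edges M') :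
      ∃ I, S.IsIdeal I ∧ M' = matchingOf I ∧ M.edges = hS.handles.descend M' := by
    obtain ⟨I, hI, rfl⟩ := exists_eq_matchingOf h.1
    have h' := hS.extends_iff.1 h
    exact ⟨I, hS.isIdeal_iff.2 ⟨hI, fun k => h'.exists_edge_mem M.isPerfectMatching k⟩, rfl,
      h'.eq_descend M.isPerfectMatching⟩
  obtain ⟨M', hM'⟩ := M.good
  obtain ⟨I, hI, rfl, hM⟩ := key M' hM'
  -- The definition of `tiles` ranges over all extensions, but they all descend to `M.edges` and
  -- hence are equal.
  have ht : M.tiles = I := by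
    ext j
    constructor
    · rintro ⟨M'', hM'', hj⟩
      obtain ⟨I', -, rfl, hM₂⟩ := key M'' hM''
      rw [← Multigraph.Handles.eq_of_descend_eq hM'.1 hM''.1 (hM.symm.trans hM₂),
        hS.noAdjacentHex.tilesEnclosed_matchingOf hI.isAdmissible] at hj
      exact hj
    · intro hj
      refine ⟨_, hM', ?_⟩
      rwa [hS.noAdjacentHex.tilesEnclosed_matchingOf hI.isAdmissible]
  rw [ht]
  exact ⟨hI, hM⟩

theorem IsRegular.tiles_injective (hS : S.IsRegular) {M N : S.Matching}
    (h : M.tiles = N.tiles) : M = N := by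
  have hM := (hS.matching_eq M).2
  rw [h, ← (hS.matching_eq N).2] at hM
  cases M
  cases N
  cases hM
  rfl

theorem IsRegular.exists_tiles_eq (hS : S.IsRegular) {I : Set (Fin (S.n + 1))}
    (hI : S.IsIdeal I) : ∃ M : S.Matching, M.tiles = I := by
  obtain ⟨hI, hk⟩ := hS.isIdeal_iff.1 hI
  have hext : S.Extends (hS.handles.descend (matchingOf I)) (matchingOf I) :=
    hS.extends_iff.2 (hS.handles.isExtension_descend hI.isPerfectMatching)
  let M : S.Matching := ⟨_, hS.handles.isPerfectMatching_descend hI.isPerfectMatching hk, _, hext⟩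
  refine ⟨M, ?_⟩
  obtain ⟨hI', hM⟩ := hS.matching_eq M
  have := Multigraph.Handles.eq_of_descend_eq hI.isPerfectMatching
    hI'.isAdmissible.isPerfectMatching hM
  rw [← hS.noAdjacentHex.tilesEnclosed_matchingOf hI, this,
    hS.noAdjacentHex.tilesEnclosed_matchingOf hI'.isAdmissible]

/-- The crossings, as elements of the poset without the auxiliary elements. -/
def crossing (j : Fin (S.n + 1)) : {x : S.PosetElement // ¬ x.IsAux} := ⟨.crossing j, id⟩

theorem exists_eq_crossing (x : {x : S.PosetElement // ¬ x.IsAux}) : ∃ j, x = crossing j := by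
  rcases x with ⟨j | ⟨i, h⟩, hx⟩
  · exact ⟨j, rfl⟩
  · exact absurd trivial hx

instance : Finite {x : S.PosetElement // ¬ x.IsAux} :=
  Finite.of_surjective crossing fun x => (exists_eq_crossing x).imp fun _ h => h.symm

/-- No generating relation starts at an auxiliary element, so a descending chain from a crossing
consists of crossings. -/
theorem IsIdeal.mem_of_le {I : Set (Fin (S.n + 1))} (hI : S.IsIdeal I) {x : S.PosetElement}
    {b : Fin (S.n + 1)} (hb : b ∈ I) (h : x ≤ .crossing b) : ∃ a ∈ I, x = .crossing a := by
  induction h using Relation.ReflTransGen.head_induction_on with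
  | refl => exact ⟨b, hb, rfl⟩
  | @head x y hxy _ ih =>
    obtain ⟨a, ha, rfl⟩ := ih
    rcases x with c | ⟨i, h⟩
    · exact ⟨c, hI _ _ hxy ha, rfl⟩
    · nomatch hxy

/-- The lower set of crossings enclosed by a matching. -/
def IsRegular.lowerSet (hS : S.IsRegular) (M : S.Matching) :
    LowerSet {x : S.PosetElement // ¬ x.IsAux} where
  carrier := {x | ∃ j ∈ M.tiles, x = crossing j}
  lower' := by
    rintro _ x hx ⟨b, hb, rfl⟩
    obtain ⟨a, ha, h⟩ := (hS.matching_eq M).1.mem_of_le hb hx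
    exact ⟨a, ha, Subtype.ext h⟩

theorem IsRegular.crossing_mem_lowerSet (hS : S.IsRegular) {M : S.Matching}
    {j : Fin (S.n + 1)} : crossing j ∈ hS.lowerSet M ↔ j ∈ M.tiles := by
  constructor
  · rintro ⟨a, ha, h⟩
    exact PosetElement.crossing.inj (congrArg Subtype.val h) ▸ ha
  · exact fun h => ⟨j, h, rfl⟩

theorem IsRegular.lowerSet_le_iff (hS : S.IsRegular) {M N : S.Matching} :
    hS.lowerSet M ≤ hS.lowerSet N ↔ M.tiles ⊆ N.tiles := by
  constructor
  · intro h j hj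
    exact hS.crossing_mem_lowerSet.1 (h (hS.crossing_mem_lowerSet.2 hj))
  · rintro h _ ⟨j, hj, rfl⟩
    exact ⟨j, h hj, rfl⟩

theorem IsRegular.lowerSet_bijective (hS : S.IsRegular) : Function.Bijective hS.lowerSet := by
  refine ⟨fun M N h => hS.tiles_injective
    ((hS.lowerSet_le_iff.1 h.le).antisymm (hS.lowerSet_le_iff.1 h.ge)), fun J => ?_⟩
  obtain ⟨M, hM⟩ := hS.exists_tiles_eq (I := {j | crossing j ∈ J}) fun a b hab hb =>
    J.lower (show crossing a ≤ crossing b from Relation.ReflTransGen.single hab) hb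
  refine ⟨M, ?_⟩
  ext x
  obtain ⟨j, rfl⟩ := exists_eq_crossing x
  rw [SetLike.mem_coe, hS.crossing_mem_lowerSet, hM]
  rfl

/-- The matchings of the snake graph form a distributive lattice, and its join-irreducible elements
form the poset of crossings. -/
theorem IsRegular.exists_distribLattice (hS : S.IsRegular)
    (hanti : ∀ x y : S.PosetElement, x ≤ y → y ≤ x → x = y) :
    ∃ _lattice : DistribLattice S.Matching,
      (∀ M N : S.Matching, M ≤ N ↔ M.tiles ⊆ N.tiles) ∧
      Nonempty ({M : S.Matching // SupIrred M} ≃o {x : S.PosetElement // ¬ x.IsAux}) := by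
  let e := Equiv.ofBijective _ hS.lowerSet_bijective
  let lattice : DistribLattice S.Matching := e.distribLattice
  -- The preorder is kept, so lower sets are unchanged; antisymmetry is needed for Birkhoff's
  -- theorem.
  let po : PartialOrder {x : S.PosetElement // ¬ x.IsAux} :=
    { (inferInstance : Preorder {x : S.PosetElement // ¬ x.IsAux}) with
      le_antisymm := fun x y h h' => Subtype.ext (hanti _ _ h h') }
  let e' : S.Matching ≃o LowerSet {x : S.PosetElement // ¬ x.IsAux} := ⟨e, Iff.rfl⟩
  have hirr (M : S.Matching) : SupIrred M ↔ SupIrred (e' M) := by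
    refine and_congr (not_congr ?_) ?_
    · rw [e'.isMin_apply]
    · refine ⟨fun h b c hbc => ?_, fun h b c hbc => ?_⟩
      · have := h (b := e'.symm b) (c := e'.symm c) (by
          rw [← e'.symm.map_sup, hbc, e'.symm_apply_apply])
        exact this.imp (fun h => by rw [← h, e'.apply_symm_apply])
          fun h => by rw [← h, e'.apply_symm_apply]
      · have := h (b := e' b) (c := e' c) (by rw [← e'.map_sup, hbc])
        exact this.imp (fun h => e'.injective h) fun h => e'.injective h
  refine ⟨lattice, fun M N => hS.lowerSet_le_iff, ⟨?_⟩⟩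
  have e₂ : {M : S.Matching // SupIrred M} ≃o
      {s : LowerSet {x : S.PosetElement // ¬ x.IsAux} // SupIrred s} :=
    ⟨e'.toEquiv.subtypeEquiv hirr, e'.map_rel_iff⟩
  -- Birkhoff's representation: in a finite poset the sup-irreducible lower sets are the principal
  -- ones.
  exact e₂.trans (@OrderIso.supIrredLowerSet _ po _).symm

end SnakeShape

/-! ### Antisymmetry through rank functions -/

namespace SnakeShape

variable {S : SnakeShape}

/-- Only crossings need a rank: auxiliary elements are never below anything else, so they can be
given rank `⊤`. -/
theorem antisymm_of_rank (f : Fin (S.n + 1) → ℤ)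
    (hf : ∀ a b, S.Generating (.crossing a) (.crossing b) → f a < f b) (x y : S.PosetElement)
    (hxy : x ≤ y) (hyx : y ≤ x) : x = y := by
  let g : S.PosetElement → WithTop ℤ
    | .crossing j => f j
    | .aux _ _ => ⊤
  have hg {x y : S.PosetElement} (h : S.Generating x y) : g x < g y := by
    rcases x with a | ⟨i, hi⟩
    · rcases y with b | ⟨i, hi⟩
      · exact WithTop.coe_lt_coe.2 (hf a b h)
      · exact WithTop.coe_lt_top _
    · nomatch h
  have key {x y : S.PosetElement} (h : x ≤ y) : x = y ∨ g x < g y := by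
    induction h with
    | refl => exact Or.inl rfl
    | tail _ hyz ih =>
      rcases ih with rfl | h
      · exact Or.inr (hg hyz)
      · exact Or.inr (h.trans (hg hyz))
  rcases key hxy with h | h
  · exact h
  · rcases key hyx with h' | h'
    · exact h'.symm
    · exact absurd h' h.asymm

theorem exists_partialSum {n : ℕ} (w : Fin n → ℤ) :
    ∃ f : Fin (n + 1) → ℤ, f 0 = 0 ∧ ∀ i : Fin n, f i.succ = f i.castSucc + w i :=
  ⟨fun j => Fin.induction (motive := fun _ => ℤ) 0 (fun i x => x + w i) j, rfl, fun _ => rfl⟩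

/-- The other `n - 1` steps raise the sum by at most `n - 1`, which cannot make up for a drop of `n
+ 1`. -/
theorem le_last_of_step {n : ℕ} {w : Fin n → ℤ} {f : Fin (n + 1) → ℤ} (h0 : f 0 = 0)
    (hf : ∀ i : Fin n, f i.succ = f i.castSucc + w i) (hw : ∀ i, w i ≤ 1) {k : Fin n}
    (hk : w k ≤ -(n + 1)) : f (Fin.last n) < 0 := by
  have key (j : Fin (n + 1)) : f j ≤ j.val ∧ (k.val < j.val → f j ≤ j.val - (n + 2)) := by
    induction j using Fin.induction with
    | zero => simp [h0]
    | succ i ih =>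
      rw [hf]
      simp only [Fin.val_castSucc, Fin.val_succ, Nat.cast_add, Nat.cast_one] at ih ⊢
      have hi := hw i
      refine ⟨by linarith, fun hki => ?_⟩
      rcases Nat.lt_succ_iff_lt_or_eq.1 hki with h | h
      · linarith [ih.2 h]
      · obtain rfl := Fin.ext h
        linarith
  have := (key (Fin.last n)).2 k.isLt
  simp only [Fin.val_last] at this
  linarith

/-- If all turns agreed with the closing one, the relations would form a cycle. Turns equal to the
closing turn get step `1`, and all others get a drop so large that the one differing turn makes the
total negative, as the closing relation requires. For a closing right turn the sign of the rank is
reversed. -/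
theorem IsRegular.exists_rank_of_closing (hS : S.IsRegular) {t : Turn}
    (ht : S.closing = some t) : ∃ f : Fin (S.n + 1) → ℤ,
      ∀ a b, S.Generating (.crossing a) (.crossing b) → f a < f b := by
  obtain ⟨hhex, hs, he, k, hk⟩ := hS.closing t ht
  rcases t with _ | _ | _
  · let w (i : Fin S.n) : ℤ := if S.turn i = .left then 1 else -(S.n + 1)
    obtain ⟨f, h0, hf⟩ := exists_partialSum w
    have hlast := le_last_of_step h0 hf (fun i => by dsimp only [w]; split <;> omega)
      (show w k ≤ _ by simp [w, hk])
    refine ⟨f, fun a b hab => ?_⟩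
    cases hab with
    | left i h => simp [hf, w, h]
    | right i h => simp [hf, w, h]; omega
    | closeLeft h => rwa [h0]
    | closeRight h => simp [ht] at h
    | startHook i h => simp [hs] at h
    | endHook i h => simp [he] at h
  · let w (i : Fin S.n) : ℤ := if S.turn i = .right then 1 else -(S.n + 1)
    obtain ⟨f, h0, hf⟩ := exists_partialSum w
    have hlast := le_last_of_step h0 hf (fun i => by dsimp only [w]; split <;> omega)
      (show w k ≤ _ by simp [w, hk])
    refine ⟨fun j => -f j, fun a b hab => ?_⟩
    cases hab with
    | left i h => simp [hf, w, h]
    | right i h => simp [hf, w, h]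
    | closeLeft h => simp [ht] at h
    | closeRight h => simpa [h0] using hlast
    | startHook i h => simp [hs] at h
    | endHook i h => simp [he] at h
  · exact absurd rfl hhex

/-- Left turns go up by `2` and right turns down by `2`, except that the turn joining a hook to the
plain arc has step of size `1`. A start hook descends by at least `2` before rising by `1`, so
`i.succ` ends below `0`. After the drop of `1` into an end hook, the hook climbs by at least `2`, so
the last crossing ends above `i.castSucc`. -/
theorem IsRegular.exists_rank_of_closing_eq_none (hS : S.IsRegular) (hc : S.closing = none) :
    ∃ f : Fin (S.n + 1) → ℤ,
      ∀ a b, S.Generating (.crossing a) (.crossing b) → f a < f b := by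
  let w (i : Fin S.n) : ℤ :=
    match S.turn i with
    | .left => if S.startHook = some i then 1 else 2
    | .right => if S.endHook = some i then -1 else -2
    | .hex => 0
  obtain ⟨f, h0, hf⟩ := exists_partialSum w
  refine ⟨f, fun a b hab => ?_⟩
  cases hab with
  | left i h =>
    simp only [hf, w, h]
    split <;> omega
  | right i h =>
    simp only [hf, w, h]
    split <;> omega
  | closeLeft h => simp [hc] at h
  | closeRight h => simp [hc] at h
  | startHook i h =>
    obtain ⟨hpos, hi, hlt⟩ := hS.startHook i h
    have key (j : Fin (S.n + 1)) : j.val ≤ i.val → f j = -2 * j.val := by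
      induction j using Fin.induction with
      | zero => simp [h0]
      | succ k ih =>
        intro hk
        simp only [Fin.val_castSucc, Fin.val_succ] at ih hk ⊢
        -- An end hook lies after the start hook, so no step of size `1` occurs here.
        have hne : S.endHook ≠ some k := fun hk' => by
          have := hS.lt i h k hk'
          omega
        simp only [hf, ih (by omega), w, hlt k (by omega), if_neg hne]
        push_cast
        ring
    have hk := key i.castSucc (by simp)
    have hs : S.startHook = some i := h
    simp only [hf, w, hi, hk, h0, hs, if_true, Fin.val_castSucc]
    omega
  | endHook i h =>
    obtain ⟨hpos, hi, hlt⟩ := hS.endHook i h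
    have key (j : Fin (S.n + 1)) : i.val + 1 ≤ j.val →
        f i.castSucc - 1 + 2 * (j.val - (i.val + 1)) ≤ f j := by
      induction j using Fin.induction with
      | zero => simp
      | succ k ih =>
        intro hk
        simp only [Fin.val_castSucc, Fin.val_succ] at ih hk ⊢
        rcases (Nat.succ_le_succ_iff.1 hk).eq_or_lt with h' | h'
        · obtain rfl := Fin.ext h'
          have he : S.endHook = some i := h
          simp [hf, w, hi, he]
        · have hne : S.startHook ≠ some k := fun hk' => by
            have := hS.lt k hk' i h
            omega
          have := ih (by omega)
          simp only [hf k, w, hlt k h', if_neg hne]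
          push_cast
          omega
    have hk := key (Fin.last S.n) (by simp only [Fin.val_last]; omega)
    simp only [Fin.val_last] at hk
    omega

theorem IsRegular.antisymm (hS : S.IsRegular) (x y : S.PosetElement) (hxy : x ≤ y)
    (hyx : y ≤ x) : x = y := by
  obtain ⟨f, hf⟩ : ∃ f : Fin (S.n + 1) → ℤ,
      ∀ a b, S.Generating (.crossing a) (.crossing b) → f a < f b := by
    rcases hc : S.closing with _ | t
    · exact hS.exists_rank_of_closing_eq_none hc
    · exact hS.exists_rank_of_closing hc
  exact antisymm_of_rank f hf x y hxy hyx

end SnakeShape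

/-! ### Curves on orbifolds have regular shapes -/

namespace TriangulatedOrbifold

variable {O : TriangulatedOrbifold.{u, v}}

theorem turn_inl_ne_hex (t t' : O.Tri) (i i' : Fin 3) (k : ℕ) :
    O.turn (.inl (t, i)) (.inl (t', i')) k ≠ .hex := by
  unfold turn
  split <;> simp_all
  split <;> simp

namespace CrossingSequence

variable (c : O.CrossingSequence)

/-- A hexagonal turn happens only in a pending triangle, and the other side of a pending arc is an
ordinary triangle, where the next turn is left or right. -/
theorem noAdjacentHex {i j : Fin c.n} (hij : i.succ = j.castSucc) (h : c.turnAt i = .hex) :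
    c.turnAt j ≠ .hex := by
  have hp := c.passage i
  unfold turnAt at h ⊢
  rw [← hij]
  have hp' := c.passage j
  rw [← hij] at hp'
  rcases h₁ : O.glue (c.exit i.castSucc) with ⟨t, a⟩ | p <;>
    rcases h₂ : c.exit i.succ with ⟨t', a'⟩ | q <;> rw [h₁, h₂] at h hp
  · exact absurd h (turn_inl_ne_hex _ _ _ _ _)
  · exact hp.elim
  · exact hp.elim
  · obtain ⟨⟨t, a⟩, ht⟩ := O.glue_pend q
    rw [h₂] at hp'
    rw [ht] at hp' ⊢
    rcases h₃ : c.exit j.succ with ⟨t', a'⟩ | r <;> rw [h₃] at hp'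
    · exact turn_inl_ne_hex _ _ _ _ _
    · exact hp'.elim

/-- The curve enters the triangle through side `i + 1` and leaves through `i`, which is `(i + 1) +
2` modulo `3`. -/
theorem IsStartHook.turnAt {c : O.CrossingSequence} {j : Fin c.n} (h : c.IsStartHook j) :
    c.turnAt j = .left := by
  obtain ⟨-, t, i, -, h₁, h₂, -⟩ := h
  rw [CrossingSequence.turnAt, h₁, h₂]
  have : ∀ i : Fin 3, i ≠ i + 1 + 1 := by decide
  simp [turn, this i]

theorem IsEndHook.turnAt {c : O.CrossingSequence} {j : Fin c.n} (h : c.IsEndHook j) :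
    c.turnAt j = .right := by
  obtain ⟨-, t, i, h₁, h₂, -⟩ := h
  rw [CrossingSequence.turnAt, h₁, h₂]
  simp [turn]

theorem IsClosedCurve.closingTurn_ne_hex {c : O.CrossingSequence} (h : c.IsClosedCurve) :
    c.closingTurn ≠ .hex := by
  obtain ⟨⟨t, i, i', -, h₁, h₂⟩, -⟩ := h
  rw [closingTurn, h₁, h₂]
  exact turn_inl_ne_hex _ _ _ _ _

end CrossingSequence

/-- The shape of a curve is regular. -/
theorem Curve.isRegular_shape (γ : O.Curve) : γ.shape.IsRegular := by
  cases γ with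
  | arc c s t hs ht hlt =>
    refine ⟨?_, ?_, hlt, ?_, fun i j => c.noAdjacentHex⟩
    · rintro (i : Fin c.n) hi
      replace hi : s = some i := hi
      subst hi
      replace hs : c.IsStartHook i := hs
      have hturn := hs.turnAt
      obtain ⟨hpos, _, _, -, -, -, hlt, -⟩ := hs
      exact ⟨hpos, hturn, hlt⟩
    · rintro (i : Fin c.n) hi
      replace hi : t = some i := hi
      subst hi
      replace ht : c.IsEndHook i := ht
      have hturn := ht.turnAt
      obtain ⟨hpos, _, _, -, -, -, hlt, -⟩ := ht
      exact ⟨hpos, hturn, hlt⟩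
    · rintro t ⟨⟩
  | closed c h =>
    refine ⟨?_, ?_, ?_, ?_, fun i j => c.noAdjacentHex⟩
    · rintro i ⟨⟩
    · rintro i ⟨⟩
    · rintro i ⟨⟩
    · rintro t ⟨⟩
      exact ⟨h.closingTurn_ne_hex, rfl, rfl, h.2⟩

end TriangulatedOrbifold

theorem mainTheorem9 (O : TriangulatedOrbifold.{u, v}) (γ : O.Curve) :
    (∀ x y : γ.shape.PosetElement, x ≤ y → y ≤ x → x = y) ∧
    ∃ _lattice : DistribLattice γ.shape.Matching,
      (∀ M N : γ.shape.Matching, M ≤ N ↔ M.tiles ⊆ N.tiles) ∧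
      Nonempty ({M : γ.shape.Matching // SupIrred M} ≃o
        {x : γ.shape.PosetElement // ¬ x.IsAux}) :=
  ⟨γ.isRegular_shape.antisymm,
    γ.isRegular_shape.exists_distribLattice γ.isRegular_shape.antisymm⟩
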